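/- Let $\gamma=(x,y):[0,1]\to\mathbb R^2$ be a $C^1$ path with $|\dot\gamma_t|=L$ for all $t\in[0,1]$, where $|\cdot|$ is the $\ell^1$ norm on $\mathbb R^2$, and assume that $\dot\gamma$ is not constant (that is, $\gamma$ is not a straight segment; in particular $L>0$). For a word $w=e_{i_1}\cdots e_{i_m}$ in the letters $x,y$ let $$C(w)=\int_{0<u_1<\cdots<u_m<1} d\gamma^{i_1}_{u_1}\cdots d\gamma^{i_m}_{u_m}$$ be its coefficient in the signature of $\gamma$. For integers $n,k\ge 1$, a word $w=e_{i_1}\cdots e_{i_{k-1}}$ and a multi-index $\ell=(\ell_1,\dots,\ell_k)\in\{0,\dots,n\}^k$, define the symmetrized signature $$\mathcal S^{2n}_k(w,\ell)=\sum_{w'}C(w'),$$ where $w'$ runs over all words $w'=w_1 e_{i_1}w_2e_{i_2}\cdots e_{i_{k-1}}w_k$ in which each block $w_j$ consists of $2\ell_j$ letters $x$ and $2n-2\ell_j$ letters $y$. For real $\kappa>0$ let $\delta_\kappa=\sup\{|\dot\gamma_s-\dot\gamma_t| : s,t\in[0,1],\ |s-t|<1/\kappa\}$, and put $$\epsilon_k=\sqrt{\delta_k/L}+\sqrt{1/k},\qquad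 \eta_k=\delta_{1/(3\epsilon_k)}=\sup_{|s-t|<3\epsilon_k}|\dot\gamma_s-\dot\gamma_t| .$$ For $1\le j\le k$ let $\Delta_jx=x_{j/k}-x_{(j-1)/k}$, $\Delta_jy=y_{j/k}-y_{(j-1)/k}$ and $r_j=|\Delta_jx|/(|\Delta_jx|+|\Delta_jy|)$, so that $|\Delta_jx|:|\Delta_jy|=r_j:(1-r_j)$. Then there is $k_0$, depending only on $\gamma$, such that the following holds for every integer $k\ge k_0$, every integer $n$ with $|n-k^2\log k|<1$, and every real $\theta\ge \eta_k/L$ (in particular for $\theta=\eta_k/L$, and for $\theta=\eta_k$ if $L\ge1$). (1) There exist $\rho_1,\dots,\rho_k\in[0,1]$ such that $$\Big(\sum_{w}\ \sum_{\ell:\ |\ell_j/n-\rho_j|<2\theta\text{ for all }j}|\mathcal S^{2n}_k(w,\ell)|\Big)\Big/\Big(\sum_w\sum_\ell|\mathcal S^{2n}_k(w,\ell)|\Big)>\frac12 ,\qquad(*)$$ where $w$ runs over all words of length $k-1$ and $\ell$ over $\{0,\dots,n\}^k$. (2) Any real numbers $\rho_1,\dots,\rho_k$ that satisfy $(*)$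 also satisfy $|\rho_j-r_j|<3\theta$ for all $j=1,\dots,k$. (3) The conclusion of (2) holds block by block: if for some $j$ and some real $q$ $$\Big(\sum_{w}\ \sum_{\ell:\ |\ell_j/n-q|<2\theta}|\mathcal S^{2n}_k(w,\ell)|\Big)\Big/\Big(\sum_w\sum_\ell|\mathcal S^{2n}_k(w,\ell)|\Big)>\frac12,$$ then $|q-r_j|<3\theta$. -/

import Mathlib

open Set Filter

noncomputable section

namespace SymSig

/-- The two letters: `0` is the letter `x`, `1` is the letter `y`. -/
abbrev Letter := Fin 2

/-- The derivative of a path defined on `[0,1]` (one-sided at the end points). -/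
def vel (γ : ℝ → Letter → ℝ) (t : ℝ) : Letter → ℝ := derivWithin γ (Icc 0 1) t

/-- The `ℓ¹` norm on `ℝ²`. -/
def l1 (v : Letter → ℝ) : ℝ := ∑ i, |v i|

/-- The iterated integral of `γ` along the word `w = e₁ ⋯ eₘ`, over `s < u₁ < ⋯ < uₘ < t`:
the integration variable `u` below is `u₁`. -/
def iterInt (γ : ℝ → Letter → ℝ) : List Letter → ℝ → ℝ → ℝ
  | [], _, _ => 1
  | a :: w, s, t => ∫ u in s..t, vel γ u a * iterInt γ w u t

/-- The coefficient `C(w)` of the word `w` in the signature of `γ`. -/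
def sigCoeff (γ : ℝ → Letter → ℝ) (w : List Letter) : ℝ := iterInt γ w 0 1

/-- The word `b₁ * e₁ * b₂ * e₂ * ⋯ * e_{k-1} * b_k`, where `w = e₁ ⋯ e_{k-1}`. -/
def interleave {k : ℕ} (w : Fin (k - 1) → Letter) (b : Fin k → List Letter) : List Letter :=
  (List.ofFn fun j : Fin k =>
    b j ++ if h : (j : ℕ) < k - 1 then [w ⟨j, h⟩] else []).flatten

/-- The words `b₁ * e₁ * ⋯ * e_{k-1} * b_k` whose `j`-th block `b_j` has
`2 ℓ_j` letters `x` and `2 n - 2 ℓ_j` letters `y`. -/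
def wordSet (n k : ℕ) (w : Fin (k - 1) → Letter) (l : Fin k → Fin (n + 1)) :
    Set (List Letter) :=
  {w' | ∃ b : Fin k → List Letter,
    (∀ j, (b j).count 0 = 2 * (l j : ℕ) ∧ (b j).count 1 = 2 * n - 2 * (l j : ℕ)) ∧
      w' = interleave w b}

theorem length_eq_count (w : List Letter) : w.length = w.count 0 + w.count 1 := by
  induction w with
  | nil => simp
  | cons a w ih => fin_cases a <;> simp [ih] <;> omega

theorem wordSet_finite (n k : ℕ) (w : Fin (k - 1) → Letter) (l : Fin k → Fin (n + 1)) :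
    (wordSet n k w l).Finite := by
  have hfin : {b : Fin k → List Letter | ∀ j, b j ∈ {v : List Letter | v.length = 2 * n}}.Finite :=
    Set.Finite.pi' fun _ => List.finite_length_eq Letter (2 * n)
  refine (hfin.image (interleave w)).subset ?_
  rintro w' ⟨b, hb, rfl⟩
  refine ⟨b, fun j => ?_, rfl⟩
  have h := hb j
  have h2 := (l j).isLt
  change (b j).length = 2 * n
  rw [length_eq_count]
  omega

/-- The symmetrized signature: the sum of `C(w')` over all words `w'` of `wordSet n k w l`. -/
def symSig (γ : ℝ → Letter → ℝ) (n k : ℕ) (w : Fin (k - 1) → Letter)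
    (l : Fin k → Fin (n + 1)) : ℝ :=
  ∑ w' ∈ (wordSet_finite n k w l).toFinset, sigCoeff γ w'

/-- The total mass of the symmetrized signatures. -/
def totalMass (γ : ℝ → Letter → ℝ) (n k : ℕ) : ℝ :=
  ∑ w : Fin (k - 1) → Letter, ∑ l : Fin k → Fin (n + 1), |symSig γ n k w l|

/-- The mass of the multi-indices with `|ℓ_j / n - ρ_j| < 2 θ` for every `j`. -/
def windowMass (γ : ℝ → Letter → ℝ) (n k : ℕ) (θ : ℝ) (ρ : Fin k → ℝ) : ℝ :=
  ∑ w : Fin (k - 1) → Letter,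
    ∑ l : Fin k → Fin (n + 1) with ∀ j, |((l j : ℕ) : ℝ) / n - ρ j| < 2 * θ,
      |symSig γ n k w l|

/-- The mass of the multi-indices with `|ℓ_j / n - q| < 2 θ` for one given `j`. -/
def blockMass (γ : ℝ → Letter → ℝ) (n k : ℕ) (θ : ℝ) (j : Fin k) (q : ℝ) : ℝ :=
  ∑ w : Fin (k - 1) → Letter,
    ∑ l : Fin k → Fin (n + 1) with |((l j : ℕ) : ℝ) / n - q| < 2 * θ,
      |symSig γ n k w l|

/-- The modulus of continuity `δ_κ` of the derivative: the supremum of `|γ'(s) - γ'(t)|`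
over `s, t ∈ [0,1]` with `|s - t| < 1 / κ`. -/
def delta (γ : ℝ → Letter → ℝ) (κ : ℝ) : ℝ :=
  sSup {d | ∃ s ∈ Icc (0 : ℝ) 1, ∃ t ∈ Icc (0 : ℝ) 1,
    |s - t| < 1 / κ ∧ d = l1 (vel γ s - vel γ t)}

/-- `ε_k = √(δ_k / L) + √(1 / k)`. -/
def eps (γ : ℝ → Letter → ℝ) (L : ℝ) (k : ℕ) : ℝ :=
  √(delta γ k / L) + √(1 / (k : ℝ))

/-- `η_k = δ_{1 / (3 ε_k)}`: the oscillation of the derivative over times closer than `3 ε_k`. -/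
def eta (γ : ℝ → Letter → ℝ) (L : ℝ) (k : ℕ) : ℝ := delta γ (1 / (3 * eps γ L k))

/-- The increment of the coordinate `i` of `γ` over the `j`-th of `k` equal time intervals
(`j` counted from `0`). -/
def incr (γ : ℝ → Letter → ℝ) (k : ℕ) (j : Fin k) (i : Letter) : ℝ :=
  γ (((j : ℕ) + 1 : ℝ) / k) i - γ (((j : ℕ) : ℝ) / k) i

/-- The true unsigned direction `r_j`, with `|Δ_j x| : |Δ_j y| = r_j : (1 - r_j)`. -/
def trueDir (γ : ℝ → Letter → ℝ) (k : ℕ) (j : Fin k) : ℝ :=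
  |incr γ k j 0| / (|incr γ k j 0| + |incr γ k j 1|)

end SymSig

end

/-! Summing iterated integrals over all orderings of one block gives a product of divided powers:
the words with `p` letters `x` and `q` letters `y` over `[s,u]` contribute `(Δx)^p / p! * (Δy)^q /
q!`. Hence `symSig` is a single integral over the simplex of the times of the separating letters
(`symSig_eq_simplexInt`), whose integrand is a product of block weights times the velocity
components selected by `w`. All exponents inside the blocks are even, so the block weights are
nonnegative, and their sum over `ℓ` lies between one half of and the whole of `∏ (|Δ_j x| + |Δ_j
y|)^(2n) / (2n)!`.

Two concentrations follow. First, this product is at most `∏ (L d_j)^(2n) / (2n)!` with `d_j` the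
block lengths, which sum to `1`. A Pinsker type inequality costs a factor `exp(-4 n k ε²)` as soon
as one separating time is `ε` away from its uniform position (`weightProd_le_farBound`). A box of
side `k^(-3)` at the uniform times loses only the oscillation `δ_k` and lower order terms, and `ε_k²
≥ δ_k / L + 1 / k` makes the far region negligible against it (`farBound_le`). Secondly, at times
near the uniform ones a Chernoff bound keeps `ℓ_j / n` within `θ / 2` of the direction of the block,
and that direction is within `η_k / (2L) ≤ θ / 2` of `r_j` (`direction_sub_le`). So the
multi-indices with some `|ℓ_j / n - r_j| > θ` have relative weight at most `4 k exp(-n θ²)`. A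
nonconstant velocity forces `η_k² ≥ c / k`, so this is `exp` of minus a multiple of `k log k` and
beats any fixed exponential in `k`.

It remains to control signs. From above, absolute values summed over `w` give exactly `L^(k-1)`.
From below, the one word formed by the dominant letters at the times `i / k` has a velocity factor
of constant sign and of size at least `(L/4)^(k-1)` near the uniform times. The resulting loss
`4^(k-1)` is affordable, so the bad multi-indices carry less than half of the total mass
(`badMass_lt_half_totalMass`). The three conclusions are then the triangle inequality. -/

noncomputable section

open MeasureTheory

namespace SymSig

/-! ### Integration over the simplex of separating times -/

/-- The iterated integral of `f` over the simplex `s < u₀ < ⋯ < u_{m-1} < 1`. -/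
def simplexInt : (m : ℕ) → ((Fin m → ℝ) → ℝ) → ℝ → ℝ
  | 0, f, _ => f ![]
  | m + 1, f, s => ∫ u in s..1, simplexInt m (fun us => f (Fin.cons u us)) u

/-- The closed simplex `s ≤ u₀ ≤ ⋯ ≤ u_{m-1} ≤ 1`, described by the end points of its blocks. -/
def simplex {m : ℕ} (s : ℝ) (u : Fin m → ℝ) : Prop :=
  ∀ j : Fin (m + 1), (Fin.cons s u : Fin (m + 1) → ℝ) j ≤ (Fin.snoc u 1 : Fin (m + 1) → ℝ) j

theorem simplex_cons {m : ℕ} {s t : ℝ} {u : Fin m → ℝ} :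
    simplex s (Fin.cons t u : Fin (m + 1) → ℝ) ↔ s ≤ t ∧ simplex t u := by
  unfold simplex
  rw [Fin.forall_fin_succ, ← Fin.cons_snoc_eq_snoc_cons]
  simp

/-- Peeling off the outer integral turns its variable into both a parameter and the new lower end,
so the parameter space and the lower end `σ` have to vary in the induction. -/
theorem continuous_simplexInt {X : Type} [TopologicalSpace X] [FirstCountableTopology X] {m : ℕ}
    {f : X → (Fin m → ℝ) → ℝ} {σ : X → ℝ} (hf : Continuous (Function.uncurry f))
    (hσ : Continuous σ) : Continuous fun x => simplexInt m (f x) (σ x) := by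
  induction m generalizing X with
  | zero => exact hf.comp (Continuous.prodMk continuous_id continuous_const)
  | succ m ih =>
    have h : Continuous (Function.uncurry fun (x : X) (u : ℝ) =>
        simplexInt m (fun us => f x (Fin.cons u us)) u) := by
      refine ih (X := X × ℝ) (f := fun p us => f p.1 (Fin.cons p.2 us)) (σ := Prod.snd) ?_
        continuous_snd
      refine hf.comp (Continuous.prodMk (continuous_fst.comp continuous_fst) ?_)
      exact Continuous.finCons (A := fun _ : Fin (m + 1) => ℝ)
        (continuous_snd.comp continuous_fst) continuous_snd
    exact (intervalIntegral.continuous_parametric_intervalIntegral_of_continuous h hσ).neg.congr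
      fun x => (intervalIntegral.integral_symm _ _).symm

theorem continuous_simplexInt_cons {m : ℕ} {f : (Fin (m + 1) → ℝ) → ℝ} (hf : Continuous f) :
    Continuous fun u : ℝ => simplexInt m (fun us => f (Fin.cons u us)) u := by
  refine continuous_simplexInt (f := fun u us => f (Fin.cons u us)) (σ := id) ?_ continuous_id
  exact hf.comp (Continuous.finCons continuous_fst continuous_snd)

theorem continuous_cons_right {m : ℕ} {f : (Fin (m + 1) → ℝ) → ℝ} (hf : Continuous f) (u : ℝ) :
    Continuous fun us : Fin m → ℝ => f (Fin.cons u us) :=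
  hf.comp (Continuous.finCons continuous_const continuous_id)

theorem simplexInt_const_mul {m : ℕ} (c : ℝ) (f : (Fin m → ℝ) → ℝ) (s : ℝ) :
    simplexInt m (fun u => c * f u) s = c * simplexInt m f s := by
  induction m generalizing s with
  | zero => rfl
  | succ m ih =>
    simp only [simplexInt]
    rw [← intervalIntegral.integral_const_mul]
    exact intervalIntegral.integral_congr fun u _ => ih _ u

theorem simplexInt_sum {m : ℕ} {ι : Type*} (S : Finset ι) {f : ι → (Fin m → ℝ) → ℝ}
    (hf : ∀ i ∈ S, Continuous (f i)) (s : ℝ) :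
    simplexInt m (fun u => ∑ i ∈ S, f i u) s = ∑ i ∈ S, simplexInt m (f i) s := by
  induction m generalizing s with
  | zero => rfl
  | succ m ih =>
    simp only [simplexInt]
    rw [← intervalIntegral.integral_finsetSum fun i hi =>
      (continuous_simplexInt_cons (hf i hi)).intervalIntegrable _ _]
    exact intervalIntegral.integral_congr fun u _ =>
      ih (fun i hi => continuous_cons_right (hf i hi) u) u

theorem simplexInt_mono {m : ℕ} {f g : (Fin m → ℝ) → ℝ} (hf : Continuous f) (hg : Continuous g)
    {s : ℝ} (hs : s ≤ 1) (h : ∀ u, simplex s u → f u ≤ g u) :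
    simplexInt m f s ≤ simplexInt m g s := by
  induction m generalizing s with
  | zero => exact h _ fun j => by fin_cases j; simpa [Fin.snoc] using hs
  | succ m ih =>
    refine intervalIntegral.integral_mono_on hs
      ((continuous_simplexInt_cons hf).intervalIntegrable _ _)
      ((continuous_simplexInt_cons hg).intervalIntegrable _ _) fun t ht => ?_
    exact ih (continuous_cons_right hf t) (continuous_cons_right hg t) ht.2
      fun u hu => h _ (simplex_cons.2 ⟨ht.1, hu⟩)

theorem simplexInt_zero (m : ℕ) (s : ℝ) : simplexInt m (fun _ => 0) s = 0 := by
  simpa using simplexInt_const_mul (m := m) 0 (fun _ => 0) s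

theorem simplexInt_nonneg {m : ℕ} {f : (Fin m → ℝ) → ℝ} (hf : Continuous f)
    {s : ℝ} (hs : s ≤ 1) (h : ∀ u, simplex s u → 0 ≤ f u) : 0 ≤ simplexInt m f s := by
  rw [← simplexInt_zero m s]
  exact simplexInt_mono continuous_const hf hs h

theorem simplexInt_sub {m : ℕ} {f g : (Fin m → ℝ) → ℝ} (hf : Continuous f) (hg : Continuous g)
    (s : ℝ) : simplexInt m (fun u => f u - g u) s = simplexInt m f s - simplexInt m g s := by
  have := simplexInt_sum (m := m) (Finset.univ : Finset (Fin 2)) (f := ![f, fun u => -1 * g u])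
    (fun i _ => by
      fin_cases i
      exacts [hf, hg.const_mul (-1)]) s
  simp only [Fin.sum_univ_two, Matrix.cons_val_zero, Matrix.cons_val_one,
    simplexInt_const_mul] at this
  simpa [sub_eq_add_neg] using this

theorem abs_simplexInt_le {m : ℕ} {f g : (Fin m → ℝ) → ℝ} (hf : Continuous f) (hg : Continuous g)
    {s : ℝ} (hs : s ≤ 1) (h : ∀ u, simplex s u → |f u| ≤ g u) :
    |simplexInt m f s| ≤ simplexInt m g s := by
  rw [abs_le]
  refine ⟨?_, simplexInt_mono hf hg hs fun u hu => (abs_le.1 (h u hu)).2⟩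
  have := simplexInt_mono (f := fun u => -1 * g u) (hg.const_mul (-1)) hf hs fun u hu => by
    simpa using (abs_le.1 (h u hu)).1
  rw [simplexInt_const_mul] at this
  linarith

theorem simplexInt_one_le {m : ℕ} {s : ℝ} (hs : s ∈ Icc (0 : ℝ) 1) :
    simplexInt m (fun _ => 1) s ≤ 1 := by
  induction m generalizing s with
  | zero => exact le_rfl
  | succ m ih =>
    have h := intervalIntegral.integral_mono_on (μ := volume) hs.2
      ((continuous_simplexInt_cons (m := m) (f := fun _ => 1) continuous_const).intervalIntegrable
        _ _)
      ((continuous_const (y := (1 : ℝ))).intervalIntegrable _ _) fun t ht =>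
        ih ⟨hs.1.trans ht.1, ht.2⟩
    simp only [intervalIntegral.integral_const, smul_eq_mul, mul_one] at h
    exact h.trans (by linarith [hs.1])

/-- A lower bound of a simplex integral by the integral over a box. -/
theorem le_simplexInt_of_box {m : ℕ} {f : (Fin m → ℝ) → ℝ} (hf : Continuous f) {s c h : ℝ}
    (hs : s ≤ 1) (hh : 0 ≤ h) (a : Fin m → ℝ)
    (hf0 : ∀ u, simplex s u → 0 ≤ f u)
    (ha : ∀ u : Fin m → ℝ, (∀ j, u j ∈ Icc (a j) (a j + h)) → simplex s u ∧ c ≤ f u) :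
    h ^ m * c ≤ simplexInt m f s := by
  induction m generalizing s with
  | zero => simpa [simplexInt] using (ha ![] (by simp)).2
  | succ m ih =>
    have hcons : ∀ t ∈ Icc (a 0) (a 0 + h), ∀ u : Fin m → ℝ,
        (∀ j, u j ∈ Icc (a j.succ) (a j.succ + h)) →
        (s ≤ t ∧ simplex t u) ∧ c ≤ f (Fin.cons t u) := by
      intro t ht u hu
      rw [← simplex_cons]
      exact ha _ (Fin.cases (by simpa using ht) (by simpa using hu))
    -- A nonempty simplex has its lower end below `1`; at the top of the first side of the box this
    -- gives `a 0 + h ≤ 1`.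
    have hle1 : ∀ (m : ℕ) (t : ℝ) (u : Fin m → ℝ), simplex t u → t ≤ 1 := by
      intro m
      induction m with
      | zero => intro t u hu; simpa [Fin.snoc] using hu 0
      | succ m ih =>
        intro t u hu
        rw [← Fin.cons_self_tail u, simplex_cons] at hu
        exact hu.1.trans (ih _ _ hu.2)
    have hbase : ∀ j : Fin m, (fun j : Fin m => a j.succ) j ∈ Icc (a j.succ) (a j.succ + h) :=
      fun j => ⟨le_rfl, by simpa using hh⟩
    have hsa : s ≤ a 0 := (hcons (a 0) ⟨le_rfl, by linarith⟩ _ hbase).1.1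
    have hb1 : a 0 + h ≤ 1 :=
      hle1 _ _ _ (hcons (a 0 + h) ⟨by linarith, le_rfl⟩ _ hbase).1.2
    have hcont := continuous_simplexInt_cons hf
    have hnn : ∀ t ∈ Icc s 1, 0 ≤ simplexInt m (fun us => f (Fin.cons t us)) t := fun t ht =>
      simplexInt_nonneg (continuous_cons_right hf t) ht.2 fun u hu =>
        hf0 _ (simplex_cons.2 ⟨ht.1, hu⟩)
    have h1 : ∫ _ in (a 0)..(a 0 + h), h ^ m * c ≤
        ∫ t in (a 0)..(a 0 + h), simplexInt m (fun us => f (Fin.cons t us)) t := by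
      refine intervalIntegral.integral_mono_on (by linarith)
        (continuous_const.intervalIntegrable _ _)
        (hcont.intervalIntegrable _ _) fun t ht => ?_
      exact ih (continuous_cons_right hf t) (ht.2.trans hb1) (fun j => a j.succ)
        (fun u hu => hf0 _ (simplex_cons.2 ⟨hsa.trans ht.1, hu⟩))
        fun u hu => ⟨(hcons t ht u hu).1.2, (hcons t ht u hu).2⟩
    have h2 : ∫ t in (a 0)..(a 0 + h), simplexInt m (fun us => f (Fin.cons t us)) t ≤
        ∫ t in s..1, simplexInt m (fun us => f (Fin.cons t us)) t := by
      refine intervalIntegral.integral_mono_interval hsa (by linarith) hb1 ?_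
        (hcont.intervalIntegrable _ _)
      filter_upwards [ae_restrict_mem measurableSet_Ioc] with t ht
      exact hnn t ⟨ht.1.le, ht.2⟩
    simp only [intervalIntegral.integral_const, smul_eq_mul, add_sub_cancel_left] at h1
    calc h ^ (m + 1) * c = h * (h ^ m * c) := by ring
      _ ≤ _ := h1.trans h2

/-- Interchange of the order of integration over a triangle. -/
theorem integral_triangle_swap {f : ℝ → ℝ → ℝ} (hf : Continuous (Function.uncurry f)) {s t : ℝ}
    (hst : s ≤ t) :
    ∫ r in s..t, ∫ u in r..t, f r u = ∫ u in s..t, ∫ r in s..u, f r u := by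
  set T : Set (ℝ × ℝ) := {p | p.1 ≤ p.2}
  have hT : MeasurableSet T := measurableSet_le measurable_fst measurable_snd
  -- Both iterated integrals are integrals over the square of the same function cut off to the
  -- triangle `r ≤ u`.
  set F : ℝ → ℝ → ℝ := fun r u => T.indicator (Function.uncurry f) (r, u) with hF
  have hint : IntegrableOn (Function.uncurry F) (uIoc s t ×ˢ uIoc s t) := by
    have h1 : IntegrableOn (Function.uncurry f) (Icc s t ×ˢ Icc s t) :=
      hf.continuousOn.integrableOn_compact (isCompact_Icc.prod isCompact_Icc)
    have h2 : IntegrableOn (Function.uncurry f) (uIoc s t ×ˢ uIoc s t) := by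
      refine h1.mono_set (prod_mono ?_ ?_) <;> rw [uIoc_of_le hst] <;> exact Ioc_subset_Icc_self
    exact h2.indicator hT
  have hswap := intervalIntegral_intervalIntegral_swap hint
  have hl : ∫ r in s..t, ∫ u in s..t, F r u = ∫ r in s..t, ∫ u in r..t, f r u := by
    rw [intervalIntegral.integral_of_le hst, intervalIntegral.integral_of_le hst]
    refine setIntegral_congr_fun measurableSet_Ioc fun r hr => ?_
    have : ∀ u, F r u = (Ici r).indicator (f r) u := fun u => rfl
    simp only [this]
    rw [intervalIntegral.integral_of_le hst, intervalIntegral.integral_of_le hr.2,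
      setIntegral_indicator measurableSet_Ici, ← integral_Icc_eq_integral_Ioc]
    congr 2
    ext u
    simp only [mem_inter_iff, mem_Ioc, mem_Ici, mem_Icc]
    exact ⟨fun h => ⟨h.2, h.1.2⟩, fun h => ⟨⟨hr.1.trans_le h.1, h.2⟩, h.1⟩⟩
  have hr : ∫ u in s..t, ∫ r in s..t, F r u = ∫ u in s..t, ∫ r in s..u, f r u := by
    rw [intervalIntegral.integral_of_le hst, intervalIntegral.integral_of_le hst]
    refine setIntegral_congr_fun measurableSet_Ioc fun u hu => ?_
    have : ∀ r, F r u = (Iic u).indicator (fun r => f r u) r := fun r => rfl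
    simp only [this]
    rw [intervalIntegral.integral_of_le hst, intervalIntegral.integral_of_le hu.1.le,
      setIntegral_indicator measurableSet_Iic, Ioc_inter_Iic, min_eq_right hu.2]
  rw [← hl, ← hr, hswap]

/-! ### Summation over the words of one block -/

variable {v : ℝ → Letter → ℝ}

/-- The displacement of the coordinate `i` over `[s,t]` of a path with velocity `v`. -/
def disp (v : ℝ → Letter → ℝ) (i : Letter) (s t : ℝ) : ℝ := ∫ r in s..t, v r i

theorem continuous_disp (hv : Continuous v) (i : Letter) :
    Continuous fun p : ℝ × ℝ => disp v i p.1 p.2 := by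
  have hvi : Continuous fun t => v t i := (continuous_apply i).comp hv
  have h0 : ∀ p : ℝ × ℝ, disp v i p.1 p.2 = (∫ r in 0..p.2, v r i) - ∫ r in 0..p.1, v r i :=
    fun p => (intervalIntegral.integral_interval_sub_left (hvi.intervalIntegrable _ _)
      (hvi.intervalIntegrable _ _)).symm
  have h1 : Continuous fun t => ∫ r in (0 : ℝ)..t, v r i :=
    intervalIntegral.continuous_primitive (fun a b => hvi.intervalIntegrable a b) 0
  simp only [h0]
  exact (h1.comp continuous_snd).sub (h1.comp continuous_fst)

theorem Continuous.disp {X : Type*} [TopologicalSpace X] (hv : Continuous v) (i : Letter)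
    {f g : X → ℝ} (hf : Continuous f) (hg : Continuous g) :
    Continuous fun x => disp v i (f x) (g x) :=
  (continuous_disp hv i).comp (hf.prodMk hg)

theorem hasDerivAt_disp_left (hv : Continuous v) (i : Letter) (r u : ℝ) :
    HasDerivAt (fun r => disp v i r u) (-v r i) r := by
  have hvi : Continuous fun t => v t i := (continuous_apply i).comp hv
  exact intervalIntegral.integral_hasDerivAt_left (hvi.intervalIntegrable _ _)
    (hvi.stronglyMeasurableAtFilter _ _) hvi.continuousAt

/-- The normalized monomial `x ^ p / p!`. -/
def divPow (p : ℕ) (x : ℝ) : ℝ := x ^ p / (p.factorial : ℝ)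

theorem continuous_divPow (p : ℕ) : Continuous (divPow p) := by
  unfold divPow
  fun_prop

theorem hasDerivAt_divPow_succ (p : ℕ) (x : ℝ) :
    HasDerivAt (divPow (p + 1)) (divPow p x) x := by
  have h := (hasDerivAt_pow (p + 1) x).div_const (((p + 1).factorial : ℕ) : ℝ)
  refine h.congr_deriv ?_
  unfold divPow
  rw [Nat.factorial_succ]
  push_cast
  have : (p.factorial : ℝ) ≠ 0 := by positivity
  field_simp

@[simp] theorem divPow_zero (x : ℝ) : divPow 0 x = 1 := by simp [divPow]

theorem divPow_succ_zero (p : ℕ) : divPow (p + 1) 0 = 0 := by simp [divPow]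

/-- The sum of the iterated integrals over `[s,u]` of all words with `p` letters `x` and
`q` letters `y`. -/
def shuffleMono (v : ℝ → Letter → ℝ) (p q : ℕ) (s u : ℝ) : ℝ :=
  divPow p (disp v 0 s u) * divPow q (disp v 1 s u)

theorem Continuous.shuffleMono {X : Type*} [TopologicalSpace X] (hv : Continuous v) (p q : ℕ)
    {f g : X → ℝ} (hf : Continuous f) (hg : Continuous g) :
    Continuous fun x => shuffleMono v p q (f x) (g x) :=
  ((continuous_divPow p).comp (Continuous.disp hv 0 hf hg)).mul
    ((continuous_divPow q).comp (Continuous.disp hv 1 hf hg))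

/-- The iterated integral along `w` over `s < u₁ < ⋯ < uₘ < 1`, with `F(uₘ)` as a factor of the
integrand. -/
def wordInt (v : ℝ → Letter → ℝ) : List Letter → (ℝ → ℝ) → ℝ → ℝ
  | [], F, s => F s
  | a :: w, F, s => ∫ u in s..1, v u a * wordInt v w F u

theorem wordInt_append (w₁ w₂ : List Letter) (F : ℝ → ℝ) :
    wordInt v (w₁ ++ w₂) F = wordInt v w₁ (wordInt v w₂ F) := by
  induction w₁ with
  | nil => rfl
  | cons a w ih =>
    funext s
    simp only [List.cons_append, wordInt, ih]

theorem continuous_integral_left {g : ℝ → ℝ} (hg : Continuous g) :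
    Continuous fun s : ℝ => ∫ u in s..1, g u :=
  (intervalIntegral.continuous_primitive (fun a b => hg.intervalIntegrable a b) 1).neg.congr
    fun _ => (intervalIntegral.integral_symm _ _).symm

theorem continuous_wordInt (hv : Continuous v) (w : List Letter) {F : ℝ → ℝ} (hF : Continuous F) :
    Continuous (wordInt v w F) := by
  induction w with
  | nil => exact hF
  | cons a w ih =>
    exact continuous_integral_left (((continuous_apply a).comp hv).mul ih)

/-- The words with `p` letters `x` and `q` letters `y`. -/
def words : ℕ → ℕ → Finset (List Letter)
  | 0, 0 => {[]}
  | p + 1, 0 => (words p 0).image (List.cons 0)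
  | 0, q + 1 => (words 0 q).image (List.cons 1)
  | p + 1, q + 1 => (words p (q + 1)).image (List.cons 0) ∪ (words (p + 1) q).image (List.cons 1)
termination_by p q => p + q

theorem mem_words {p q : ℕ} {w : List Letter} :
    w ∈ words p q ↔ w.count 0 = p ∧ w.count 1 = q := by
  induction w generalizing p q with
  | nil => rcases p with _ | p <;> rcases q with _ | q <;> simp [words]
  | cons a w ih =>
    rcases p with _ | p <;> rcases q with _ | q <;> fin_cases a <;> simp [words, ih]

theorem sum_words_succ_zero (p : ℕ) (f : List Letter → ℝ) :
    ∑ w ∈ words (p + 1) 0, f w = ∑ w ∈ words p 0, f (0 :: w) := by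
  rw [words, Finset.sum_image (List.cons_injective.injOn)]

theorem sum_words_zero_succ (q : ℕ) (f : List Letter → ℝ) :
    ∑ w ∈ words 0 (q + 1), f w = ∑ w ∈ words 0 q, f (1 :: w) := by
  rw [words, Finset.sum_image (List.cons_injective.injOn)]

theorem sum_words_succ_succ (p q : ℕ) (f : List Letter → ℝ) :
    ∑ w ∈ words (p + 1) (q + 1), f w =
      ∑ w ∈ words p (q + 1), f (0 :: w) + ∑ w ∈ words (p + 1) q, f (1 :: w) := by
  rw [words, Finset.sum_union, Finset.sum_image (List.cons_injective.injOn),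
    Finset.sum_image (List.cons_injective.injOn)]
  rw [Finset.disjoint_left]
  intro w hw hw'
  simp only [Finset.mem_image] at hw hw'
  obtain ⟨_, _, rfl⟩ := hw
  obtain ⟨_, _, h⟩ := hw'
  simp at h

/-- The transform of `c + ∫_s^1 g` by a kernel `H`. -/
def kerInt (c : ℝ) (g : ℝ → ℝ) (H : ℝ → ℝ → ℝ) (s : ℝ) : ℝ :=
  c * H s 1 + ∫ u in s..1, H s u * g u

theorem continuous_kerInt (c : ℝ) {g : ℝ → ℝ} (hg : Continuous g) {H : ℝ → ℝ → ℝ}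
    (hH : Continuous (Function.uncurry H)) : Continuous (kerInt c g H) := by
  have h1 : Continuous fun s => H s 1 := hH.comp (continuous_id.prodMk continuous_const)
  have h2 : Continuous fun s => ∫ u in s..1, H s u * g u := by
    have h : Continuous (Function.uncurry fun s u => H s u * g u) :=
      hH.mul (hg.comp continuous_snd)
    exact (intervalIntegral.continuous_parametric_intervalIntegral_of_continuous h
      continuous_id).neg.congr fun x => (intervalIntegral.integral_symm _ _).symm
  exact (h1.const_mul c).add h2

/-- A transform by a kernel is the integral of the transform by the derivative of the kernel. -/
theorem integral_kerInt (c : ℝ) {g : ℝ → ℝ} (hg : Continuous g) {H dH : ℝ → ℝ → ℝ}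
    (hdH : Continuous (Function.uncurry dH))
    (hd : ∀ r u, HasDerivAt (fun r => H r u) (-dH r u) r) (h0 : ∀ u, H u u = 0) {s : ℝ}
    (hs : s ≤ 1) :
    ∫ r in s..1, kerInt c g dH r = kerInt c g H s := by
  have hcr : ∀ u, Continuous fun r => dH r u := fun u =>
    hdH.comp (continuous_id.prodMk continuous_const)
  have hftc : ∀ u, ∫ r in s..u, dH r u = H s u := by
    intro u
    have h := intervalIntegral.integral_eq_sub_of_hasDerivAt (a := s) (b := u)
      (fun r _ => hd r u) ((hcr u).neg.intervalIntegrable _ _)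
    rw [intervalIntegral.integral_neg, h0] at h
    linarith
  have hc : Continuous (Function.uncurry fun r u => dH r u * g u) :=
    hdH.mul (hg.comp continuous_snd)
  have h2 : Continuous fun s => ∫ u in s..1, dH s u * g u :=
    (intervalIntegral.continuous_parametric_intervalIntegral_of_continuous hc
      continuous_id).neg.congr fun x => (intervalIntegral.integral_symm _ _).symm
  unfold kerInt
  rw [intervalIntegral.integral_add (((hcr 1).const_mul c).intervalIntegrable _ _)
    (h2.intervalIntegrable _ _), intervalIntegral.integral_const_mul, hftc,
    integral_triangle_swap hc hs]
  simp only [intervalIntegral.integral_mul_const, hftc]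

theorem kerInt_add (c : ℝ) {g : ℝ → ℝ} (hg : Continuous g) {H₁ H₂ : ℝ → ℝ → ℝ}
    (h₁ : Continuous (Function.uncurry H₁)) (h₂ : Continuous (Function.uncurry H₂))
    (a b : ℝ → ℝ) (r : ℝ) :
    kerInt c g (fun r u => a r * H₁ r u + b r * H₂ r u) r =
      a r * kerInt c g H₁ r + b r * kerInt c g H₂ r := by
  unfold kerInt
  have e₁ : Continuous fun u => H₁ r u * g u :=
    (h₁.comp (continuous_const.prodMk continuous_id)).mul hg
  have e₂ : Continuous fun u => H₂ r u * g u :=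
    (h₂.comp (continuous_const.prodMk continuous_id)).mul hg
  have : ∀ u, (a r * H₁ r u + b r * H₂ r u) * g u =
      a r * (H₁ r u * g u) + b r * (H₂ r u * g u) := fun u => by ring
  simp only [this]
  rw [intervalIntegral.integral_add ((e₁.const_mul _).intervalIntegrable _ _)
    ((e₂.const_mul _).intervalIntegrable _ _), intervalIntegral.integral_const_mul,
    intervalIntegral.integral_const_mul]
  ring

theorem kerInt_mul (c : ℝ) (g : ℝ → ℝ) (H : ℝ → ℝ → ℝ) (a : ℝ → ℝ) (r : ℝ) :
    kerInt c g (fun r u => a r * H r u) r = a r * kerInt c g H r := by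
  unfold kerInt
  simp only [mul_assoc]
  rw [intervalIntegral.integral_const_mul]
  ring

theorem sum_wordInt_cons (hv : Continuous v) {F : ℝ → ℝ} (hF : Continuous F) (a : Letter)
    (S : Finset (List Letter)) (s : ℝ) :
    ∑ w ∈ S, wordInt v (a :: w) F s = ∫ u in s..1, v u a * ∑ w ∈ S, wordInt v w F u := by
  simp only [wordInt, Finset.mul_sum]
  exact (intervalIntegral.integral_finsetSum fun w _ =>
    (((continuous_apply a).comp hv).mul (continuous_wordInt hv w hF)).intervalIntegrable _ _).symm

/-- The infinitesimal form of the recursion defining `words`: moving the lower end splits the words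
by their first letter. -/
theorem hasDerivAt_shuffleMono_succ_succ (hv : Continuous v) (p q : ℕ) (r u : ℝ) :
    HasDerivAt (fun r => shuffleMono v (p + 1) (q + 1) r u)
      (-(v r 0 * shuffleMono v p (q + 1) r u + v r 1 * shuffleMono v (p + 1) q r u)) r := by
  have h0 := (hasDerivAt_divPow_succ p (disp v 0 r u)).comp r (hasDerivAt_disp_left hv 0 r u)
  have h1 := (hasDerivAt_divPow_succ q (disp v 1 r u)).comp r (hasDerivAt_disp_left hv 1 r u)
  refine (h0.mul h1).congr_deriv ?_
  simp only [shuffleMono, Function.comp]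
  ring

theorem hasDerivAt_shuffleMono_succ_zero (hv : Continuous v) (p : ℕ) (r u : ℝ) :
    HasDerivAt (fun r => shuffleMono v (p + 1) 0 r u) (-(v r 0 * shuffleMono v p 0 r u)) r := by
  have h0 := (hasDerivAt_divPow_succ p (disp v 0 r u)).comp r (hasDerivAt_disp_left hv 0 r u)
  simp only [shuffleMono, divPow_zero, mul_one]
  exact h0.congr_deriv (by ring)

theorem hasDerivAt_shuffleMono_zero_succ (hv : Continuous v) (q : ℕ) (r u : ℝ) :
    HasDerivAt (fun r => shuffleMono v 0 (q + 1) r u) (-(v r 1 * shuffleMono v 0 q r u)) r := by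
  have h0 := (hasDerivAt_divPow_succ q (disp v 1 r u)).comp r (hasDerivAt_disp_left hv 1 r u)
  simp only [shuffleMono, divPow_zero, one_mul]
  exact h0.congr_deriv (by ring)

theorem disp_self (i : Letter) (u : ℝ) : disp v i u u = 0 := intervalIntegral.integral_same

/-- The sum over all words with `p` letters `x` and `q` letters `y` of the iterated integrals
with the final factor `c + ∫_s^1 g`. -/
theorem sum_words_wordInt (hv : Continuous v) {F g : ℝ → ℝ} (c : ℝ) (hg : Continuous g)
    (hF : ∀ s, F s = c + ∫ u in s..1, g u) (p q : ℕ) {s : ℝ} (hs : s ≤ 1) :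
    ∑ w ∈ words p q, wordInt v w F s = kerInt c g (shuffleMono v p q) s := by
  have hFc : Continuous F := by
    rw [show F = fun s => c + ∫ u in s..1, g u from funext hF]
    exact (continuous_integral_left hg).const_add c
  have hcont : ∀ p q, Continuous (Function.uncurry (shuffleMono v p q)) := fun p q =>
    Continuous.shuffleMono hv p q continuous_fst continuous_snd
  have hvi : ∀ (i : Letter), Continuous fun p : ℝ × ℝ => v p.1 i := fun i =>
    ((continuous_apply i).comp hv).comp continuous_fst
  have hcongr : ∀ {f₁ f₂ : ℝ → ℝ} {s : ℝ}, s ≤ 1 → (∀ r, r ≤ 1 → f₁ r = f₂ r) →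
      ∫ r in s..1, f₁ r = ∫ r in s..1, f₂ r := fun hs h =>
    intervalIntegral.integral_congr fun r hr => h r (by rw [uIcc_of_le hs] at hr; exact hr.2)
  -- Induction on the length of the words, split by first letter. The kernel `shuffleMono` satisfies
  -- the same recursion in its lower end and vanishes on the diagonal for positive length, so
  -- `integral_kerInt` performs the step.
  induction hN : p + q generalizing p q s with
  | zero =>
    obtain ⟨rfl, rfl⟩ : p = 0 ∧ q = 0 := by omega
    simp [words, kerInt, shuffleMono, wordInt, hF]
  | succ N ih =>
    rcases p with _ | p <;> rcases q with _ | q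
    · omega
    · rw [sum_words_zero_succ, sum_wordInt_cons hv hFc,
        ← integral_kerInt c hg (dH := fun r u => v r 1 * shuffleMono v 0 q r u)
          ((hvi 1).mul (hcont 0 q))
          (hasDerivAt_shuffleMono_zero_succ hv q)
          (fun u => by simp [shuffleMono, disp_self, divPow_succ_zero]) hs]
      refine hcongr hs fun r hr => ?_
      rw [ih 0 q hr (by omega)]
      exact (kerInt_mul c g (shuffleMono v 0 q) (fun r => v r 1) r).symm
    · rw [sum_words_succ_zero, sum_wordInt_cons hv hFc,
        ← integral_kerInt c hg (dH := fun r u => v r 0 * shuffleMono v p 0 r u)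
          ((hvi 0).mul (hcont p 0))
          (hasDerivAt_shuffleMono_succ_zero hv p)
          (fun u => by simp [shuffleMono, disp_self, divPow_succ_zero]) hs]
      refine hcongr hs fun r hr => ?_
      rw [ih p 0 hr (by omega)]
      exact (kerInt_mul c g (shuffleMono v p 0) (fun r => v r 0) r).symm
    · have hker : ∀ (p q : ℕ), Continuous (kerInt c g (shuffleMono v p q)) := fun p q =>
        continuous_kerInt c hg (hcont p q)
      rw [sum_words_succ_succ, sum_wordInt_cons hv hFc, sum_wordInt_cons hv hFc,
        ← integral_kerInt c hg (dH := fun r u =>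
            v r 0 * shuffleMono v p (q + 1) r u + v r 1 * shuffleMono v (p + 1) q r u)
          (((hvi 0).mul (hcont p (q + 1))).add ((hvi 1).mul (hcont (p + 1) q)))
          (hasDerivAt_shuffleMono_succ_succ hv p q)
          (fun u => by simp [shuffleMono, disp_self, divPow_succ_zero]) hs,
        ← intervalIntegral.integral_add]
      · refine hcongr hs fun r hr => ?_
        rw [ih p (q + 1) hr (by omega), ih (p + 1) q hr (by omega)]
        exact (kerInt_add c hg (hcont p (q + 1)) (hcont (p + 1) q) (fun r => v r 0)
          (fun r => v r 1) r).symm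
      all_goals
        exact (((continuous_apply _).comp hv).mul (continuous_finsetSum _ fun w _ =>
          continuous_wordInt hv w hFc)).intervalIntegrable _ _

/-! ### The symmetrized signature as a simplex integral -/

theorem interleave_zero (w : Fin 0 → Letter) (b : Fin 1 → List Letter) :
    interleave (k := 1) w b = b 0 := by
  simp [interleave]

theorem interleave_succ {m : ℕ} (w : Fin (m + 1) → Letter) (b : Fin (m + 2) → List Letter) :
    interleave (k := m + 2) w b =
      b 0 ++ [w 0] ++ interleave (k := m + 1) (fun i : Fin m => w i.succ) (fun j => b j.succ) := by
  simp only [interleave]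
  rw [List.ofFn_succ, List.flatten_cons]
  congr 1
  simp

/-- Blocks of a common length can be read off from positions, so a sum over the set of words is a
sum over families of blocks without repetition. -/
theorem interleave_injective {m N : ℕ} (w : Fin m → Letter) {b b' : Fin (m + 1) → List Letter}
    (hb : ∀ j, (b j).length = N) (hb' : ∀ j, (b' j).length = N)
    (h : interleave (k := m + 1) w b = interleave (k := m + 1) w b') : b = b' := by
  induction m with
  | zero =>
    rw [interleave_zero, interleave_zero] at h
    funext j
    fin_cases j
    exact h
  | succ m ih =>
    rw [interleave_succ, interleave_succ] at h
    obtain ⟨h1, h2⟩ := List.append_inj h (by simp [hb, hb'])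
    have h0 := (List.append_inj h1 (by rw [hb, hb'])).1
    have ht := ih (fun i => w i.succ) (fun j => hb j.succ) (fun j => hb' j.succ) h2
    funext j
    refine Fin.cases h0 (fun i => congrFun ht i) j

/-- The normalized weight of a block with `2 l` letters `x` and `2 n - 2 l` letters `y`. -/
def blockWeight (v : ℝ → Letter → ℝ) (n l : ℕ) (s u : ℝ) : ℝ :=
  shuffleMono v (2 * l) (2 * n - 2 * l) s u

/-- The integrand of the symmetrized signature over the simplex of the separating times. -/
def symIntegrand (v : ℝ → Letter → ℝ) (n : ℕ) {m : ℕ} (w : Fin m → Letter)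
    (l : Fin (m + 1) → ℕ) (s : ℝ) (u : Fin m → ℝ) : ℝ :=
  (∏ j : Fin (m + 1), blockWeight v n (l j) ((Fin.cons s u : Fin (m + 1) → ℝ) j)
    ((Fin.snoc u 1 : Fin (m + 1) → ℝ) j)) * ∏ i : Fin m, v (u i) (w i)

theorem symIntegrand_cons (n : ℕ) {m : ℕ} (w : Fin (m + 1) → Letter)
    (l : Fin (m + 2) → ℕ) (s t : ℝ) (u : Fin m → ℝ) :
    symIntegrand v n w l s (Fin.cons t u) = blockWeight v n (l 0) s t * v t (w 0) *
      symIntegrand v n (fun i => w i.succ) (fun j => l j.succ) t u := by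
  unfold symIntegrand
  rw [Fin.prod_univ_succ,
    Fin.prod_univ_succ fun i : Fin (m + 1) => v ((Fin.cons t u : Fin (m + 1) → ℝ) i) (w i),
    ← Fin.cons_snoc_eq_snoc_cons]
  simp only [Fin.cons_zero, Fin.cons_succ]
  ring

theorem continuous_cons_apply {m : ℕ} (s : ℝ) (j : Fin (m + 1)) :
    Continuous fun u : Fin m → ℝ => (Fin.cons s u : Fin (m + 1) → ℝ) j := by
  refine Fin.cases ?_ (fun i => ?_) j
  · simpa using continuous_const
  · simpa using continuous_apply i

theorem continuous_snoc_apply {m : ℕ} (t : ℝ) (j : Fin (m + 1)) :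
    Continuous fun u : Fin m → ℝ => (Fin.snoc u t : Fin (m + 1) → ℝ) j := by
  refine Fin.lastCases ?_ (fun i => ?_) j
  · simpa using continuous_const
  · simpa using continuous_apply i

theorem continuous_blockWeight_ends (hv : Continuous v) (n l : ℕ) {m : ℕ} (s : ℝ)
    (j : Fin (m + 1)) : Continuous fun u : Fin m → ℝ =>
      blockWeight v n l ((Fin.cons s u : Fin (m + 1) → ℝ) j)
        ((Fin.snoc u 1 : Fin (m + 1) → ℝ) j) :=
  Continuous.shuffleMono hv _ _ (continuous_cons_apply s j) (continuous_snoc_apply 1 j)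

theorem continuous_symIntegrand (hv : Continuous v) (n : ℕ) {m : ℕ} (w : Fin m → Letter)
    (l : Fin (m + 1) → ℕ) (s : ℝ) : Continuous (symIntegrand v n w l s) :=
  (continuous_finsetProd _ fun j _ => continuous_blockWeight_ends hv n (l j) s j).mul
    (continuous_finsetProd _ fun i _ =>
      (continuous_apply (w i)).comp (hv.comp (continuous_apply i)))

/-- The families of blocks, the `j`-th one with `2 l_j` letters `x` and `2 n - 2 l_j` letters
`y`. -/
def blocks (n : ℕ) {m : ℕ} (l : Fin m → ℕ) : Finset (Fin m → List Letter) :=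
  Fintype.piFinset fun j => words (2 * l j) (2 * n - 2 * l j)

theorem sum_blocks_succ (n : ℕ) {m : ℕ} (l : Fin (m + 1) → ℕ)
    (f : (Fin (m + 1) → List Letter) → ℝ) :
    ∑ b ∈ blocks n l, f b = ∑ b ∈ blocks n (fun j => l j.succ),
      ∑ b₀ ∈ words (2 * l 0) (2 * n - 2 * l 0), f (Fin.cons b₀ b) := by
  rw [← Finset.sum_product']
  refine Finset.sum_nbij' (fun b => (Fin.tail b, b 0)) (fun p => Fin.cons p.2 p.1) ?_ ?_ ?_ ?_ ?_
  · intro b hb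
    simp only [blocks, Fintype.mem_piFinset, Finset.mem_product] at hb ⊢
    exact ⟨fun j => hb j.succ, hb 0⟩
  · intro p hp
    simp only [blocks, Fintype.mem_piFinset, Finset.mem_product] at hp ⊢
    exact Fin.cases hp.2 hp.1
  · intro b _
    exact Fin.cons_self_tail b
  · intro p _
    simp
  · intro b _
    simp

/-- With the later blocks fixed, the first block sees them only through a function of its end time.
Summing over its words replaces them by the block weight, and the induction hypothesis handles the
remaining blocks. -/
theorem sum_blocks_wordInt (hv : Continuous v) (n : ℕ) {m : ℕ} (w : Fin m → Letter)
    (l : Fin (m + 1) → ℕ) {s : ℝ} (hs : s ≤ 1) :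
    ∑ b ∈ blocks n l, wordInt v (interleave (k := m + 1) w b) (fun _ => 1) s =
      simplexInt m (symIntegrand v n w l s) s := by
  induction m generalizing s with
  | zero =>
    rw [sum_blocks_succ]
    have h : blocks n (fun j : Fin 0 => l j.succ) = {![]} := by
      ext b
      simp [blocks, Subsingleton.elim b ![], eq_iff_true_of_subsingleton]
    rw [h, Finset.sum_singleton]
    simp only [interleave_zero, Fin.cons_zero]
    -- The last block runs up to time `1` with no separating letter after it: the final factor is
    -- the constant `1`.
    rw [sum_words_wordInt hv (g := fun _ => 0) 1 continuous_const (by simp) _ _ hs]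
    simp [kerInt, simplexInt, symIntegrand, blockWeight, Fin.snoc]
  | succ m ih =>
    rw [sum_blocks_succ]
    simp only [interleave_succ, Fin.cons_zero, Fin.cons_succ, List.append_assoc, wordInt_append]
    have hW : ∀ b : Fin (m + 1) → List Letter, Continuous
        (wordInt v (interleave (k := m + 1) (fun i : Fin m => w i.succ) b) fun _ => 1) :=
      fun b => continuous_wordInt hv _ continuous_const
    have hg : ∀ b : Fin (m + 1) → List Letter, Continuous fun u => v u (w 0) *
        wordInt v (interleave (k := m + 1) (fun i : Fin m => w i.succ) b) (fun _ => 1) u :=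
      fun b => ((continuous_apply (w 0)).comp hv).mul (hW b)
    have hstep : ∀ b : Fin (m + 1) → List Letter,
        ∑ b₀ ∈ words (2 * l 0) (2 * n - 2 * l 0), wordInt v b₀ (wordInt v [w 0]
          (wordInt v (interleave (k := m + 1) (fun i : Fin m => w i.succ) b) fun _ => 1)) s =
        ∫ u in s..1, blockWeight v n (l 0) s u * (v u (w 0) *
          wordInt v (interleave (k := m + 1) (fun i : Fin m => w i.succ) b) (fun _ => 1) u) := by
      intro b
      -- Every other block is followed by a separating letter, so its final factor is a pure
      -- integral and the constant is `0`.
      rw [sum_words_wordInt hv 0 (hg b) (fun s => by simp [wordInt]) _ _ hs]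
      simp [kerInt, blockWeight]
    simp only [hstep]
    rw [← intervalIntegral.integral_finsetSum]
    · simp only [simplexInt]
      refine intervalIntegral.integral_congr fun u hu => ?_
      rw [uIcc_of_le hs] at hu
      simp only [symIntegrand_cons, simplexInt_const_mul]
      rw [← ih _ _ hu.2, Finset.mul_sum]
      exact Finset.sum_congr rfl fun b _ => by ring
    · intro b _
      exact ((Continuous.shuffleMono hv _ _ continuous_const continuous_id).mul
        (hg b)).intervalIntegrable _ _

theorem symSig_eq_sum_blocks (γ : ℝ → Letter → ℝ) (n m : ℕ) (w : Fin m → Letter)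
    (l : Fin (m + 1) → Fin (n + 1)) :
    symSig γ n (m + 1) w l =
      ∑ b ∈ blocks n (fun j => (l j : ℕ)), sigCoeff γ (interleave (k := m + 1) w b) := by
  classical
  have hlen : ∀ b ∈ blocks n (fun j => (l j : ℕ)), ∀ j, (b j).length = 2 * n := by
    intro b hb j
    have h : (b j).count 0 = 2 * (l j : ℕ) ∧ (b j).count 1 = 2 * n - 2 * (l j : ℕ) :=
      mem_words.1 (Fintype.mem_piFinset.1 hb j)
    have := (l j).isLt
    rw [length_eq_count, h.1, h.2]
    omega
  have himg : (wordSet_finite n (m + 1) w l).toFinset =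
      (blocks n (fun j => (l j : ℕ))).image (interleave (k := m + 1) w) := by
    ext w'
    simp only [Finite.mem_toFinset, Finset.mem_image, blocks, Fintype.mem_piFinset, mem_words,
      wordSet, mem_ofPred_eq]
    exact ⟨fun ⟨b, hb, h⟩ => ⟨b, hb, h.symm⟩, fun ⟨b, hb, h⟩ => ⟨b, hb, h.symm⟩⟩
  unfold symSig
  rw [himg, Finset.sum_image]
  exact fun b hb b' hb' h => interleave_injective w (hlen b hb) (hlen b' hb') h

theorem iterInt_eq_wordInt {γ : ℝ → Letter → ℝ} (hv : ∀ t ∈ Icc (0 : ℝ) 1, v t = vel γ t)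
    (w : List Letter) {s : ℝ} (hs : s ∈ Icc (0 : ℝ) 1) :
    iterInt γ w s 1 = wordInt v w (fun _ => 1) s := by
  induction w generalizing s with
  | nil => rfl
  | cons a w ih =>
    refine intervalIntegral.integral_congr fun u hu => ?_
    rw [uIcc_of_le hs.2] at hu
    have hu' : u ∈ Icc (0 : ℝ) 1 := ⟨hs.1.trans hu.1, hu.2⟩
    simp only [ih hu', hv u hu']

/-- The symmetrized signature as one integral over the simplex of the separating times. -/
theorem symSig_eq_simplexInt {γ : ℝ → Letter → ℝ} (hvc : Continuous v)
    (hv : ∀ t ∈ Icc (0 : ℝ) 1, v t = vel γ t) (n m : ℕ) (w : Fin m → Letter)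
    (l : Fin (m + 1) → Fin (n + 1)) :
    symSig γ n (m + 1) w l = simplexInt m (symIntegrand v n w (fun j => (l j : ℕ)) 0) 0 := by
  rw [symSig_eq_sum_blocks, ← sum_blocks_wordInt hvc n w _ zero_le_one]
  exact Finset.sum_congr rfl fun b _ => iterInt_eq_wordInt hv _ ⟨le_rfl, zero_le_one⟩

/-! ### Concentration of the block lengths -/

/-- Hoeffding's lemma for a Bernoulli variable. -/
theorem bernoulli_mgf_le {p : ℝ} (hp : p ∈ Icc (0 : ℝ) 1) (t : ℝ) :
    1 - p + p * Real.exp t ≤ Real.exp (t * p + t ^ 2 / 8) := by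
  set μ : Measure ℝ := ENNReal.ofReal (1 - p) • Measure.dirac 0 + ENNReal.ofReal p • Measure.dirac 1
    with hμ
  have h1p : 0 ≤ 1 - p := by linarith [hp.2]
  have hprob : IsProbabilityMeasure μ := ⟨by
    simp [hμ, ← ENNReal.ofReal_add h1p hp.1]⟩
  have hint : ∀ f : ℝ → ℝ, ∫ x, f x ∂μ = (1 - p) * f 0 + p * f 1 := by
    intro f
    have hi : ∀ (c : ℝ) (x : ℝ), Integrable f (ENNReal.ofReal c • Measure.dirac x) := fun c x =>
      Integrable.smul_measure (integrable_dirac (by simp [enorm])) ENNReal.ofReal_ne_top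
    rw [hμ, integral_add_measure (hi _ _) (hi _ _), integral_smul_measure, integral_smul_measure,
      integral_dirac, integral_dirac, ENNReal.toReal_ofReal h1p, ENNReal.toReal_ofReal hp.1]
    simp
  have hae : ∀ᵐ x ∂μ, id x ∈ Icc (0 : ℝ) 1 := by
    rw [hμ, ae_add_measure_iff]
    constructor
    · exact Measure.ae_smul_measure (by rw [ae_dirac_eq]; simp) _
    · exact Measure.ae_smul_measure (by rw [ae_dirac_eq]; simp) _
  have h := (ProbabilityTheory.hasSubgaussianMGF_of_mem_Icc (μ := μ) aemeasurable_id hae).mgf_le t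
  rw [ProbabilityTheory.mgf, hint, hint] at h
  simp only [id, mul_zero, mul_one, zero_add, sub_zero, zero_sub] at h
  have hc : (((‖(1 : ℝ)‖₊ / 2) ^ 2 : NNReal) : ℝ) * t ^ 2 / 2 = t ^ 2 / 8 := by
    simp
    ring
  rw [hc] at h
  calc 1 - p + p * Real.exp t
      = Real.exp (t * p) * ((1 - p) * Real.exp (t * -p) + p * Real.exp (t * (1 - p))) := by
        rw [mul_add, mul_left_comm, ← Real.exp_add, mul_left_comm, ← Real.exp_add]
        rw [show t * p + t * -p = 0 by ring, show t * p + t * (1 - p) = t by ring, Real.exp_zero,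
          mul_one]
    _ ≤ Real.exp (t * p) * Real.exp (t ^ 2 / 8) := by gcongr
    _ = _ := (Real.exp_add _ _).symm

theorem prod_le_mean_pow {k : ℕ} (hk : 0 < k) {z : Fin k → ℝ} (hz : ∀ i, 0 ≤ z i) :
    ∏ i, z i ≤ ((∑ i, z i) / k) ^ k := by
  have hk' : (k : ℝ) ≠ 0 := by positivity
  have h := Real.geom_mean_le_arith_mean_weighted Finset.univ (fun _ : Fin k => (1 / k : ℝ)) z
    (fun _ _ => by positivity) (by simp [hk']) fun i _ => hz i
  rw [← Finset.mul_sum] at h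
  calc ∏ i, z i = (∏ i, z i ^ (1 / k : ℝ)) ^ k := by
        rw [← Finset.prod_pow]
        refine Finset.prod_congr rfl fun i _ => ?_
        rw [← Real.rpow_natCast, ← Real.rpow_mul (hz i), one_div_mul_cancel hk', Real.rpow_one]
    _ ≤ (1 / k * ∑ i, z i) ^ k :=
        pow_le_pow_left₀ (Finset.prod_nonneg fun i _ => Real.rpow_nonneg (hz i) _) h k
    _ = _ := by congr 1; ring

/-- A Pinsker type inequality: a probability vector that gives the set `S` a mass far from the
uniform one has a small product. -/
theorem prod_le_of_sum_far {k : ℕ} (hk : 0 < k) {d : Fin k → ℝ} (hd : ∀ i, 0 ≤ d i)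
    (hsum : ∑ i, d i = 1) (S : Finset (Fin k)) {ε : ℝ} (hε : 0 ≤ ε)
    (hS : ε ≤ |∑ i ∈ S, d i - S.card / k|) :
    ∏ i, d i ≤ (1 / k) ^ k * Real.exp (-(2 * k * ε ^ 2)) := by
  set x := ∑ i ∈ S, d i - S.card / k with hx
  set p := ∑ i ∈ S, d i with hp
  -- The vector `d` is tilted by `exp t` on `S` before applying the inequality of the means. The
  -- resulting exponent is `k (t x + t² / 8)`, and `t = -4 x` minimizes it, with value `-2 k x²`.
  set t : ℝ := -4 * x
  have hk' : (k : ℝ) ≠ 0 := by positivity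
  have hp01 : p ∈ Icc (0 : ℝ) 1 := by
    refine ⟨Finset.sum_nonneg fun i _ => hd i, ?_⟩
    rw [← hsum]
    exact Finset.sum_le_sum_of_subset_of_nonneg (Finset.subset_univ _) fun i _ _ => hd i
  set z : Fin k → ℝ := fun i => d i * if i ∈ S then Real.exp t else 1 with hz
  have hz0 : ∀ i, 0 ≤ z i := fun i => mul_nonneg (hd i) (by split_ifs <;> positivity)
  have hzs : ∑ i, z i = 1 - p + p * Real.exp t := by
    have : ∀ i, z i = d i + (if i ∈ S then d i * (Real.exp t - 1) else 0) := by
      intro i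
      simp only [hz]
      split_ifs <;> ring
    simp only [this]
    rw [Finset.sum_add_distrib, hsum, Finset.sum_ite_mem, Finset.univ_inter, ← Finset.sum_mul]
    ring
  have hzp : ∏ i, z i = (∏ i, d i) * Real.exp (t * S.card) := by
    simp only [hz]
    rw [Finset.prod_mul_distrib, Finset.prod_ite_mem, Finset.univ_inter, Finset.prod_const,
      ← Real.exp_nat_mul]
    ring_nf
  have h := prod_le_mean_pow hk hz0
  rw [hzp, hzs] at h
  have hb := bernoulli_mgf_le hp01 t
  have h0 : 0 ≤ 1 - p + p * Real.exp t := by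
    have := hp01.1; have := hp01.2; have := Real.exp_pos t
    nlinarith
  have h2 : ((1 - p + p * Real.exp t) / k) ^ k ≤
      (1 / k) ^ k * Real.exp (k * (t * p + t ^ 2 / 8)) := by
    rw [Real.exp_nat_mul, ← mul_pow]
    refine pow_le_pow_left₀ (by positivity) ?_ k
    rw [one_div_mul_eq_div]
    gcongr
  have h3 : ∏ i, d i ≤ (1 / k) ^ k * Real.exp (k * (t * p + t ^ 2 / 8)) *
      Real.exp (-(t * S.card)) := by
    rw [Real.exp_neg, ← div_eq_mul_inv, le_div_iff₀ (Real.exp_pos _)]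
    exact h.trans h2
  refine h3.trans ?_
  rw [mul_assoc, ← Real.exp_add]
  refine mul_le_mul_of_nonneg_left (Real.exp_le_exp.2 ?_) (by positivity)
  have hc : (S.card : ℝ) = k * (p - x) := by
    rw [hx]
    field_simp
    ring
  rw [hc]
  have hxx : ε ^ 2 ≤ x ^ 2 := by
    rw [← sq_abs x]
    exact pow_le_pow_left₀ hε hS 2
  have : k * (t * p + t ^ 2 / 8) + -(t * (k * (p - x))) = -(2 * k * x ^ 2) := by
    simp only [t]
    ring
  rw [this]
  have hk0 : (0 : ℝ) ≤ k := by positivity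
  nlinarith

/-! ### Even binomial terms and their tails -/

theorem sum_divPow (N : ℕ) (a b : ℝ) :
    ∑ i ∈ Finset.range (N + 1), divPow i a * divPow (N - i) b = divPow N (a + b) := by
  unfold divPow
  rw [add_pow, Finset.sum_div]
  refine Finset.sum_congr rfl fun i hi => ?_
  have hi' : i ≤ N := Nat.lt_succ_iff.1 (Finset.mem_range.1 hi)
  rw [Nat.cast_choose ℝ hi']
  have h1 : (i.factorial : ℝ) ≠ 0 := by positivity
  have h2 : ((N - i).factorial : ℝ) ≠ 0 := by positivity
  have h3 : (N.factorial : ℝ) ≠ 0 := by positivity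
  field_simp

theorem sum_range_even_odd (n : ℕ) (f : ℕ → ℝ) :
    ∑ i ∈ Finset.range (2 * n + 1), f i =
      ∑ l ∈ Finset.range (n + 1), f (2 * l) + ∑ l ∈ Finset.range n, f (2 * l + 1) := by
  induction n with
  | zero => simp
  | succ n ih =>
    rw [show 2 * (n + 1) + 1 = 2 * n + 1 + 1 + 1 by ring, Finset.sum_range_succ,
      Finset.sum_range_succ, ih, Finset.sum_range_succ _ (n + 1), Finset.sum_range_succ _ n,
      Finset.sum_range_succ _ n]
    ring_nf

/-- The terms with an even number of letters `x` in the binomial expansion of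
`(a + b) ^ (2 n) / (2 n)!`. -/
def evenTerm (n : ℕ) (a b : ℝ) (l : ℕ) : ℝ := divPow (2 * l) a * divPow (2 * n - 2 * l) b

theorem divPow_even_abs (p : ℕ) (x : ℝ) : divPow (2 * p) |x| = divPow (2 * p) x := by
  simp [divPow, pow_mul]

theorem divPow_even_nonneg (p : ℕ) (x : ℝ) : 0 ≤ divPow (2 * p) x := by
  unfold divPow
  rw [pow_mul]
  positivity

theorem divPow_le_divPow (p : ℕ) {x y : ℝ} (hx : 0 ≤ x) (h : x ≤ y) : divPow p x ≤ divPow p y := by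
  unfold divPow
  gcongr

theorem evenTerm_abs (n : ℕ) (a b : ℝ) (l : ℕ) : evenTerm n |a| |b| l = evenTerm n a b l := by
  unfold evenTerm
  rw [← Nat.mul_sub, divPow_even_abs, divPow_even_abs]

theorem evenTerm_nonneg (n : ℕ) (a b : ℝ) (l : ℕ) : 0 ≤ evenTerm n a b l := by
  unfold evenTerm
  rw [← Nat.mul_sub]
  exact mul_nonneg (divPow_even_nonneg _ _) (divPow_even_nonneg _ _)

/-- Averaging the binomial expansions for `a` and `-a` cancels the odd powers. -/
theorem sum_evenTerm (n : ℕ) (a b : ℝ) :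
    ∑ l ∈ Finset.range (n + 1), evenTerm n a b l =
      (divPow (2 * n) (a + b) + divPow (2 * n) (-a + b)) / 2 := by
  rw [← sum_divPow, ← sum_divPow, sum_range_even_odd, sum_range_even_odd]
  have h1 : ∀ l, divPow (2 * l) (-a) = divPow (2 * l) a := fun l => by simp [divPow, pow_mul]
  have h2 : ∀ l, divPow (2 * l + 1) (-a) = -divPow (2 * l + 1) a := fun l => by
    simp [divPow, pow_succ, pow_mul, neg_div]
  simp only [h1, h2, neg_mul, Finset.sum_neg_distrib, evenTerm]
  ring

theorem le_sum_evenTerm (n : ℕ) (a b : ℝ) :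
    divPow (2 * n) (|a| + |b|) / 2 ≤ ∑ l ∈ Finset.range (n + 1), evenTerm n a b l := by
  simp only [← evenTerm_abs n a b]
  rw [sum_evenTerm]
  linarith [divPow_even_nonneg n (-|a| + |b|)]

theorem sum_evenTerm_le (n : ℕ) (a b : ℝ) :
    ∑ l ∈ Finset.range (n + 1), evenTerm n a b l ≤ divPow (2 * n) (|a| + |b|) := by
  simp only [← evenTerm_abs n a b]
  rw [sum_evenTerm]
  have : divPow (2 * n) (-|a| + |b|) ≤ divPow (2 * n) (|a| + |b|) := by
    rw [← divPow_even_abs]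
    refine divPow_le_divPow _ (abs_nonneg _) ?_
    rw [abs_le]
    constructor <;> linarith [abs_nonneg a, abs_nonneg b]
  linarith

/-- The exponential tilt amounts to replacing `a` by `a * exp t`, so the tilted sum is again bounded
by one power, whose base is controlled by `bernoulli_mgf_le`. -/
theorem sum_exp_evenTerm_le (n : ℕ) {a b : ℝ} (ha : 0 ≤ a) (hb : 0 ≤ b) (hab : 0 < a + b)
    (t : ℝ) :
    ∑ l ∈ Finset.range (n + 1), Real.exp (t * (2 * l)) * evenTerm n a b l ≤
      divPow (2 * n) (a + b) * Real.exp (2 * n * (t * (a / (a + b)) + t ^ 2 / 8)) := by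
  have h1 : ∀ l : ℕ, Real.exp (t * (2 * l)) * evenTerm n a b l =
      evenTerm n (a * Real.exp t) b l := by
    intro l
    unfold evenTerm divPow
    rw [mul_pow, ← Real.exp_nat_mul]
    push_cast
    ring_nf
  simp only [h1]
  refine (sum_evenTerm_le n _ b).trans ?_
  rw [abs_of_nonneg (by positivity : 0 ≤ a * Real.exp t), abs_of_nonneg hb]
  set p := a / (a + b) with hp
  have hp01 : p ∈ Icc (0 : ℝ) 1 := ⟨by positivity, by rw [div_le_one hab]; linarith⟩
  have h2 : a * Real.exp t + b = (a + b) * (1 - p + p * Real.exp t) := by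
    rw [hp]
    field_simp
    ring
  have h3 := bernoulli_mgf_le hp01 t
  have h4 : (0 : ℝ) ≤ a * Real.exp t + b := by positivity
  refine (divPow_le_divPow _ h4 (h2.le.trans (mul_le_mul_of_nonneg_left h3 hab.le))).trans_eq ?_
  unfold divPow
  rw [mul_pow, ← Real.exp_nat_mul]
  push_cast
  ring

/-- The Chernoff bound for the even terms of a binomial expansion. -/
theorem sum_evenTerm_tail_le {n : ℕ} (hn : 0 < n) (a b : ℝ) {τ : ℝ} (hτ : 0 ≤ τ) :
    ∑ l ∈ Finset.range (n + 1) with τ < |(l : ℕ) / (n : ℝ) - |a| / (|a| + |b|)|,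
        evenTerm n a b l ≤
      4 * Real.exp (-(4 * n * τ ^ 2)) * ∑ l ∈ Finset.range (n + 1), evenTerm n a b l := by
  rcases (add_nonneg (abs_nonneg a) (abs_nonneg b)).eq_or_lt' with hab | hab
  · have h0 : ∑ l ∈ Finset.range (n + 1), evenTerm n a b l ≤ 0 := by
      refine (sum_evenTerm_le n a b).trans ?_
      rw [hab]
      simp [divPow, hn.ne']
    have h1 : ∑ l ∈ Finset.range (n + 1), evenTerm n a b l = 0 :=
      le_antisymm h0 (Finset.sum_nonneg fun l _ => evenTerm_nonneg n a b l)
    rw [h1, mul_zero, ← h1]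
    exact Finset.sum_le_sum_of_subset_of_nonneg (Finset.filter_subset _ _)
      fun l _ _ => evenTerm_nonneg n a b l
  set r := |a| / (|a| + |b|) with hr
  have hn' : (0 : ℝ) < n := by exact_mod_cast hn
  -- Markov bounds with tilts `4 τ` and `-4 τ`, which minimize `2 n (t² / 8 - τ |t|)`, with value
  -- `-4 n τ²`. The constant `4` comes from the two sides and from the factor `1 / 2` in
  -- `le_sum_evenTerm`.
  have hkey : ∀ l : ℕ, τ < |(l : ℝ) / n - r| → evenTerm n a b l ≤
      Real.exp (-(8 * n * τ * (r + τ))) * (Real.exp (4 * τ * (2 * l)) * evenTerm n |a| |b| l) +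
      Real.exp (8 * n * τ * (r - τ)) * (Real.exp (-4 * τ * (2 * l)) * evenTerm n |a| |b| l) := by
    intro l hl
    have he := evenTerm_nonneg n a b l
    have hln : (l : ℝ) = n * ((l : ℝ) / n) := by field_simp
    have hexp : ∀ x y e : ℝ, Real.exp x * (Real.exp y * e) = Real.exp (x + y) * e := fun x y e => by
      rw [Real.exp_add, mul_assoc]
    rw [evenTerm_abs, hexp, hexp, ← add_mul]
    refine le_mul_of_one_le_left he ?_
    rcases lt_abs.1 hl with h | h
    · refine (Real.one_le_exp ?_).trans (le_add_of_nonneg_right (Real.exp_pos _).le)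
      rw [hln, show -(8 * n * τ * (r + τ)) + 4 * τ * (2 * (n * ((l : ℝ) / n))) =
        8 * n * τ * ((l : ℝ) / n - r - τ) by ring]
      exact mul_nonneg (by positivity) (by linarith)
    · refine (Real.one_le_exp ?_).trans (le_add_of_nonneg_left (Real.exp_pos _).le)
      rw [hln, show 8 * n * τ * (r - τ) + -4 * τ * (2 * (n * ((l : ℝ) / n))) =
        8 * n * τ * (-((l : ℝ) / n - r) - τ) by ring]
      exact mul_nonneg (by positivity) (by linarith)
  have h1 : ∑ l ∈ Finset.range (n + 1) with τ < |(l : ℕ) / (n : ℝ) - r|, evenTerm n a b l ≤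
      ∑ l ∈ Finset.range (n + 1), (Real.exp (-(8 * n * τ * (r + τ))) *
        (Real.exp (4 * τ * (2 * l)) * evenTerm n |a| |b| l) +
      Real.exp (8 * n * τ * (r - τ)) * (Real.exp (-4 * τ * (2 * l)) * evenTerm n |a| |b| l)) := by
    refine (Finset.sum_le_sum fun l hl => hkey l (Finset.mem_filter.1 hl).2).trans ?_
    refine Finset.sum_le_sum_of_subset_of_nonneg (Finset.filter_subset _ _) fun l _ _ => ?_
    have := evenTerm_nonneg n |a| |b| l
    positivity
  rw [Finset.sum_add_distrib, ← Finset.mul_sum, ← Finset.mul_sum] at h1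
  have h2 := sum_exp_evenTerm_le n (abs_nonneg a) (abs_nonneg b) hab (4 * τ)
  have h3 := sum_exp_evenTerm_le n (abs_nonneg a) (abs_nonneg b) hab (-4 * τ)
  have h4 := le_sum_evenTerm n a b
  rw [← hr] at h2 h3
  have e2 := mul_le_mul_of_nonneg_left h2 (Real.exp_pos (-(8 * n * τ * (r + τ)))).le
  have e3 := mul_le_mul_of_nonneg_left h3 (Real.exp_pos (8 * n * τ * (r - τ))).le
  rw [mul_left_comm, ← Real.exp_add,
    show -(8 * n * τ * (r + τ)) + 2 * n * (4 * τ * r + (4 * τ) ^ 2 / 8) = -(4 * n * τ ^ 2) by ring]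
    at e2
  rw [mul_left_comm, ← Real.exp_add,
    show 8 * n * τ * (r - τ) + 2 * n * (-4 * τ * r + (-4 * τ) ^ 2 / 8) = -(4 * n * τ ^ 2) by ring]
    at e3
  have e4 := mul_le_mul_of_nonneg_right h4 (Real.exp_pos (-(4 * n * τ ^ 2))).le
  linarith

/-! ### Displacements and directions of blocks -/

variable {L : ℝ}

theorem l1_eq (w : Letter → ℝ) : l1 w = |w 0| + |w 1| := by simp [l1, Fin.sum_univ_two]

theorem intervalIntegrable_apply (hv : Continuous v) (i : Letter) (a b : ℝ) :
    IntervalIntegrable (fun t => v t i) volume a b :=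
  ((continuous_apply i).comp hv).intervalIntegrable _ _

theorem intervalIntegrable_abs_apply (hv : Continuous v) (i : Letter) (a b : ℝ) :
    IntervalIntegrable (fun t => |v t i|) volume a b :=
  ((continuous_apply i).comp hv).abs.intervalIntegrable _ _

theorem integral_abs_add_integral_abs (hv : Continuous v) (hL : ∀ t, l1 (v t) = L) (a b : ℝ) :
    (∫ t in a..b, |v t 0|) + ∫ t in a..b, |v t 1| = L * (b - a) := by
  rw [← intervalIntegral.integral_add (intervalIntegrable_abs_apply hv 0 _ _)
    (intervalIntegrable_abs_apply hv 1 _ _)]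
  simp only [← l1_eq, hL, intervalIntegral.integral_const, smul_eq_mul]
  ring

theorem abs_disp_le (i : Letter) {a b : ℝ} (hab : a ≤ b) :
    |disp v i a b| ≤ ∫ t in a..b, |v t i| :=
  intervalIntegral.abs_integral_le_integral_abs hab

theorem abs_disp_add_le (hv : Continuous v) (hL : ∀ t, l1 (v t) = L) {a b : ℝ} (hab : a ≤ b) :
    |disp v 0 a b| + |disp v 1 a b| ≤ L * (b - a) := by
  rw [← integral_abs_add_integral_abs hv hL]
  exact add_le_add (abs_disp_le 0 hab) (abs_disp_le 1 hab)

/-- Comparison with the straight path of velocity `w`: the displacement differs from its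
displacement by at most `δ (b - a)` in `ℓ¹` norm. -/
theorem le_abs_disp_add (hv : Continuous v) {a b δ : ℝ} (hab : a ≤ b) {w : Letter → ℝ}
    (hw : l1 w = L) (h : ∀ t ∈ Icc a b, l1 (v t - w) ≤ δ) :
    (L - δ) * (b - a) ≤ |disp v 0 a b| + |disp v 1 a b| := by
  have hc : Continuous fun t => v t - w := hv.sub continuous_const
  have hd : ∀ i, disp (fun t => v t - w) i a b = disp v i a b - w i * (b - a) := by
    intro i
    simp only [disp, Pi.sub_apply]
    rw [intervalIntegral.integral_sub (intervalIntegrable_apply hv i _ _)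
      intervalIntegrable_const, intervalIntegral.integral_const, smul_eq_mul, mul_comm (w i)]
  have hsum : |disp v 0 a b - w 0 * (b - a)| + |disp v 1 a b - w 1 * (b - a)| ≤ δ * (b - a) := by
    rw [← hd, ← hd]
    refine (add_le_add (abs_disp_le 0 hab) (abs_disp_le 1 hab)).trans ?_
    rw [← intervalIntegral.integral_add (intervalIntegrable_abs_apply hc 0 _ _)
      (intervalIntegrable_abs_apply hc 1 _ _)]
    simp only [← l1_eq]
    have hi : IntervalIntegrable (fun t => l1 (v t - w)) volume a b := by
      simp only [l1_eq]
      exact (intervalIntegrable_abs_apply hc 0 _ _).add (intervalIntegrable_abs_apply hc 1 _ _)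
    have := intervalIntegral.integral_mono_on hab hi
      (intervalIntegrable_const (c := δ)) h
    rwa [intervalIntegral.integral_const, smul_eq_mul, mul_comm] at this
  have hb : 0 ≤ b - a := sub_nonneg.2 hab
  have h0 := abs_sub_abs_le_abs_sub (w 0 * (b - a)) (disp v 0 a b)
  have h1 := abs_sub_abs_le_abs_sub (w 1 * (b - a)) (disp v 1 a b)
  rw [abs_sub_comm, abs_mul, abs_of_nonneg hb] at h0 h1
  rw [l1_eq] at hw
  have : L * (b - a) = |w 0| * (b - a) + |w 1| * (b - a) := by rw [← hw]; ring
  rw [sub_mul]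
  linarith

/-- The unsigned direction of the increment over `[a,b]`. -/
def direction (v : ℝ → Letter → ℝ) (a b : ℝ) : ℝ :=
  |disp v 0 a b| / (|disp v 0 a b| + |disp v 1 a b|)

theorem direction_mem (a b : ℝ) : direction v a b ∈ Icc (0 : ℝ) 1 := by
  unfold direction
  exact ⟨by positivity, div_le_one_of_le₀ (by linarith [abs_nonneg (disp v 1 a b)])
    (by positivity)⟩

/-- The coordinate `i` of `v` does not change sign on `J`. -/
def ConstSign (v : ℝ → Letter → ℝ) (i : Letter) (J : Set ℝ) : Prop :=
  (∀ t ∈ J, 0 ≤ v t i) ∨ ∀ t ∈ J, v t i ≤ 0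

theorem ConstSign.abs_disp_eq {i : Letter} {a b : ℝ} (hab : a ≤ b)
    (h : ConstSign v i (Icc a b)) : |disp v i a b| = ∫ t in a..b, |v t i| := by
  unfold disp
  rcases h with h | h
  · rw [abs_of_nonneg (intervalIntegral.integral_nonneg hab h)]
    refine intervalIntegral.integral_congr fun t ht => ?_
    rw [uIcc_of_le hab] at ht
    exact (abs_of_nonneg (h t ht)).symm
  · have : ∫ t in a..b, |v t i| = -∫ t in a..b, v t i := by
      rw [← intervalIntegral.integral_neg]
      refine intervalIntegral.integral_congr fun t ht => ?_
      rw [uIcc_of_le hab] at ht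
      exact abs_of_nonpos (h t ht)
    rw [this, abs_of_nonpos]
    have h0 : 0 ≤ ∫ t in a..b, |v t i| :=
      intervalIntegral.integral_nonneg hab fun t _ => abs_nonneg _
    linarith

theorem ConstSign.mono {i : Letter} {J J' : Set ℝ} (h : ConstSign v i J) (hJ : J' ⊆ J) :
    ConstSign v i J' :=
  h.imp (fun h t ht => h t (hJ ht)) fun h t ht => h t (hJ ht)

/-- Cancellation in `x` only lowers the direction, so for an upper bound only `y` must be free of
cancellation; `le_direction` is the mirror statement. -/
theorem direction_le (hv : Continuous v) (hL : ∀ t, l1 (v t) = L) (hL0 : 0 < L) {a b d : ℝ}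
    (hab : a ≤ b) (hs : ConstSign v 1 (Icc a b)) (hd : ∀ t ∈ Icc a b, |v t 0| ≤ d) (hdL : d ≤ L) :
    direction v a b ≤ d / L := by
  have hd0 : 0 ≤ d := (abs_nonneg _).trans (hd a ⟨le_rfl, hab⟩)
  have hX := abs_disp_le (v := v) 0 hab
  have hY := hs.abs_disp_eq hab
  have hsum := integral_abs_add_integral_abs hv hL a b
  have hM := intervalIntegral.integral_mono_on hab (intervalIntegrable_abs_apply hv 0 a b)
    (intervalIntegrable_const (c := d)) hd
  rw [intervalIntegral.integral_const, smul_eq_mul] at hM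
  refine div_le_of_le_mul₀ (by positivity) (by positivity) ?_
  rw [div_mul_eq_mul_div, le_div_iff₀ hL0, hY]
  nlinarith

theorem le_direction (hv : Continuous v) (hL : ∀ t, l1 (v t) = L) (hL0 : 0 < L) {a b c : ℝ}
    (hab : a < b) (hs : ConstSign v 0 (Icc a b)) (hc : ∀ t ∈ Icc a b, c ≤ |v t 0|) (hc0 : 0 ≤ c) :
    c / L ≤ direction v a b := by
  have hY := abs_disp_le (v := v) 1 hab.le
  have hX := hs.abs_disp_eq hab.le
  have hsum := integral_abs_add_integral_abs hv hL a b
  have hM := intervalIntegral.integral_mono_on hab.le (intervalIntegrable_const (c := c))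
    (intervalIntegrable_abs_apply hv 0 a b) hc
  rw [intervalIntegral.integral_const, smul_eq_mul] at hM
  unfold direction
  rcases (by positivity : 0 ≤ |disp v 0 a b| + |disp v 1 a b|).eq_or_lt' with h0 | h0
  · have : c = 0 := by
      have h1 := abs_nonneg (disp v 1 a b)
      nlinarith
    simp only [this, zero_div]
    positivity
  · rw [div_le_div_iff₀ hL0 h0, ← hX] at *
    nlinarith

/-- Opposite signs give `|a - a'| = |a| + |a'|`, and equal norms give `|b - b'| ≥ |b'| - |b| = |a| -
|a'|`; the sum is `2 |a|`. -/
theorem abs_le_half_of_opposite {a b a' b' L η : ℝ} (h : |a| + |b| = L) (h' : |a'| + |b'| = L)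
    (hη : |a - a'| + |b - b'| ≤ η) (hs : (0 ≤ a ∧ a' ≤ 0) ∨ (a ≤ 0 ∧ 0 ≤ a')) : |a| ≤ η / 2 := by
  have h1 := abs_sub_abs_le_abs_sub b' b
  rw [abs_sub_comm] at h1
  rcases hs with ⟨h2, h3⟩ | ⟨h2, h3⟩
  · rw [abs_of_nonneg (by linarith : 0 ≤ a - a')] at hη
    rw [abs_of_nonneg h2] at *
    rw [abs_of_nonpos h3] at *
    linarith
  · rw [abs_of_nonpos (by linarith : a - a' ≤ 0)] at hη
    rw [abs_of_nonpos h2] at *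
    rw [abs_of_nonneg h3] at *
    linarith

theorem constSign_or_abs_le (hL : ∀ t, l1 (v t) = L) {J : Set ℝ} {η : ℝ}
    (hη : ∀ s ∈ J, ∀ t ∈ J, l1 (v s - v t) ≤ η) (i : Letter) :
    ConstSign v i J ∨ ∀ t ∈ J, |v t i| ≤ η / 2 := by
  by_cases h : ConstSign v i J
  · exact Or.inl h
  right
  simp only [ConstSign, not_or, not_forall, not_le] at h
  obtain ⟨⟨s, hs, hs'⟩, ⟨r, hr, hr'⟩⟩ := h
  simp only [l1_eq, Pi.sub_apply] at hL hη
  intro t ht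
  have key : ∀ q ∈ J, ((0 ≤ v t i ∧ v q i ≤ 0) ∨ (v t i ≤ 0 ∧ 0 ≤ v q i)) → |v t i| ≤ η / 2 := by
    intro q hq hsign
    fin_cases i
    · exact abs_le_half_of_opposite (hL t) (hL q) (hη t ht q hq) hsign
    · have h1 := hL t
      have h2 := hL q
      have h3 := hη t ht q hq
      rw [add_comm] at h1 h2 h3
      exact abs_le_half_of_opposite h1 h2 h3 hsign
  rcases le_total 0 (v t i) with h | h
  · exact key s hs (Or.inl ⟨h, hs'.le⟩)
  · exact key r hr (Or.inr ⟨h, hr'.le⟩)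

/-- On the sphere of radius `L`, a change of `|v 0|` is matched by an opposite change of `|v 1|`, so
`|v 0|` varies by at most `η / 2`. If both coordinates keep their sign, every direction lies between
the extremes of `|v 0| / L`. If one changes sign it is at most `η / 2` throughout, and all
directions lie within `η / (2L)` of the same end of `[0,1]`. Both cannot change sign because `η <
L`. -/
theorem direction_sub_le (hv : Continuous v) (hL : ∀ t, l1 (v t) = L) {α β η : ℝ}
    (hηL : η < L) (hη : ∀ s ∈ Icc α β, ∀ t ∈ Icc α β, l1 (v s - v t) ≤ η) {a b a' b' : ℝ}
    (hab : a < b) (hab' : a' < b') (hJ : Icc a b ⊆ Icc α β) (hJ' : Icc a' b' ⊆ Icc α β) :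
    |direction v a b - direction v a' b'| ≤ η / (2 * L) := by
  have haJ : a ∈ Icc α β := hJ ⟨le_rfl, hab.le⟩
  have hne : (Icc α β).Nonempty := ⟨a, haJ⟩
  have hη0 : 0 ≤ η := (Finset.sum_nonneg fun _ _ => abs_nonneg _).trans (hη a haJ a haJ)
  have hL0 : 0 < L := hη0.trans_lt hηL
  have hf : Continuous fun t => |v t 0| := ((continuous_apply 0).comp hv).abs
  obtain ⟨t₁, ht₁, hmin⟩ := isCompact_Icc.exists_isMinOn hne hf.continuousOn
  obtain ⟨t₂, ht₂, hmax⟩ := isCompact_Icc.exists_isMaxOn hne hf.continuousOn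
  set c := |v t₁ 0| with hc
  set d := |v t₂ 0| with hd
  have hcle : ∀ t ∈ Icc α β, c ≤ |v t 0| := fun t ht => hmin ht
  have hdle : ∀ t ∈ Icc α β, |v t 0| ≤ d := fun t ht => hmax ht
  have hL' : ∀ t, |v t 0| + |v t 1| = L := fun t => by rw [← l1_eq, hL]
  have hdL : d ≤ L := by linarith [hL' t₂, abs_nonneg (v t₂ 1)]
  have hcd : d - c ≤ η / 2 := by
    have h := hη t₂ ht₂ t₁ ht₁
    rw [l1_eq] at h
    simp only [Pi.sub_apply] at h
    have h0 := abs_sub_abs_le_abs_sub (v t₂ 0) (v t₁ 0)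
    have h1 := abs_sub_abs_le_abs_sub (v t₁ 1) (v t₂ 1)
    rw [abs_sub_comm] at h1
    linarith [hL' t₁, hL' t₂]
  have hhalf : η / (2 * L) = η / 2 / L := by rw [div_div]
  rw [hhalf]
  have hup : ∀ {a b : ℝ}, a < b → Icc a b ⊆ Icc α β → ConstSign v 1 (Icc α β) →
      direction v a b ≤ d / L := fun h hJ hs =>
    direction_le hv hL hL0 h.le (hs.mono hJ) (fun t ht => hdle t (hJ ht)) hdL
  have hlow : ∀ {a b : ℝ}, a < b → Icc a b ⊆ Icc α β → ConstSign v 0 (Icc α β) →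
      c / L ≤ direction v a b := fun h hJ hs =>
    le_direction hv hL hL0 h (hs.mono hJ) (fun t ht => hcle t (hJ ht)) (abs_nonneg _)
  have hm := direction_mem (v := v) a b
  have hm' := direction_mem (v := v) a' b'
  rw [abs_le]
  rcases constSign_or_abs_le hL hη 0 with h0 | h0 <;>
    rcases constSign_or_abs_le hL hη 1 with h1 | h1
  · have hdiv : d / L - c / L ≤ η / 2 / L := by
      rw [← sub_div]
      gcongr
    constructor <;> linarith [hup hab hJ h1, hup hab' hJ' h1, hlow hab hJ h0, hlow hab' hJ' h0]
  · have hdiv : 1 - c / L ≤ η / 2 / L := by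
      rw [← div_self hL0.ne', ← sub_div]
      gcongr
      linarith [hL' t₁, h1 t₁ ht₁]
    constructor <;> linarith [hlow hab hJ h0, hlow hab' hJ' h0, hm.2, hm'.2]
  · have hdiv : d / L ≤ η / 2 / L := by
      gcongr
      exact h0 t₂ ht₂
    constructor <;> linarith [hup hab hJ h1, hup hab' hJ' h1, hm.1, hm'.1]
  · linarith [hL' a, h0 a haJ, h1 a haJ]

/-! ### Weights as functions of the separating times -/

/-- The nodes `0, u₀, …, u_{m-1}, 1, 1, …`. -/
def node {m : ℕ} (u : Fin m → ℝ) (r : ℕ) : ℝ :=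
  if r = 0 then 0 else if h : r - 1 < m then u ⟨r - 1, h⟩ else 1

/-- The left end point of the block `j`. -/
def lend {m : ℕ} (u : Fin m → ℝ) (j : Fin (m + 1)) : ℝ := (Fin.cons 0 u : Fin (m + 1) → ℝ) j

/-- The right end point of the block `j`. -/
def rend {m : ℕ} (u : Fin m → ℝ) (j : Fin (m + 1)) : ℝ := (Fin.snoc u 1 : Fin (m + 1) → ℝ) j

theorem lend_eq_node {m : ℕ} (u : Fin m → ℝ) (j : Fin (m + 1)) : lend u j = node u j := by
  refine Fin.cases ?_ (fun i => ?_) j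
  · simp [lend, node]
  · simp [lend, node]

theorem rend_eq_node {m : ℕ} (u : Fin m → ℝ) (j : Fin (m + 1)) : rend u j = node u (j + 1) := by
  refine Fin.lastCases ?_ (fun i => ?_) j
  · simp [rend, node]
  · simp [rend, node]

theorem sum_fin_lt {N r : ℕ} (hr : r ≤ N) (f : ℕ → ℝ) :
    ∑ j ∈ Finset.univ.filter (fun j : Fin N => (j : ℕ) < r), f j = ∑ j ∈ Finset.range r, f j := by
  rw [Finset.sum_filter, Fin.sum_univ_eq_sum_range (fun j => if j < r then f j else 0),
    ← Finset.sum_filter]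
  congr 1
  ext j
  simp only [Finset.mem_filter, Finset.mem_range]
  omega

theorem sum_length_lt {m : ℕ} (u : Fin m → ℝ) {r : ℕ} (hr : r ≤ m + 1) :
    ∑ j ∈ Finset.univ.filter (fun j : Fin (m + 1) => (j : ℕ) < r), (rend u j - lend u j) =
      node u r := by
  simp only [lend_eq_node, rend_eq_node]
  rw [sum_fin_lt hr fun j => node u (j + 1) - node u j, Finset.sum_range_sub]
  simp [node]

theorem sum_length {m : ℕ} (u : Fin m → ℝ) : ∑ j, (rend u j - lend u j) = 1 := by
  have h := sum_length_lt u (r := m + 1) le_rfl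
  rw [Finset.filter_true_of_mem fun j _ => j.isLt] at h
  rw [h]
  simp [node]

/-- The separating times `u` are closer than `ε` to the uniform ones. -/
def Near {m : ℕ} (ε : ℝ) (u : Fin m → ℝ) : Prop :=
  ∀ i : Fin m, |u i - ((i : ℕ) + 1 : ℝ) / ((m : ℝ) + 1)| < ε

/-- The sum of the weights of one block. -/
def weightSum (v : ℝ → Letter → ℝ) (n : ℕ) (s t : ℝ) : ℝ :=
  ∑ l ∈ Finset.range (n + 1), blockWeight v n l s t

/-- The product of the sums of the weights of all blocks. -/
def weightProd (v : ℝ → Letter → ℝ) (n : ℕ) {m : ℕ} (u : Fin m → ℝ) : ℝ :=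
  ∏ j, weightSum v n (lend u j) (rend u j)

theorem blockWeight_nonneg (n l : ℕ) (s t : ℝ) : 0 ≤ blockWeight v n l s t :=
  evenTerm_nonneg n _ _ l

theorem weightSum_nonneg (n : ℕ) (s t : ℝ) : 0 ≤ weightSum v n s t :=
  Finset.sum_nonneg fun l _ => blockWeight_nonneg n l s t

theorem weightProd_nonneg (n : ℕ) {m : ℕ} (u : Fin m → ℝ) : 0 ≤ weightProd v n u :=
  Finset.prod_nonneg fun _ _ => weightSum_nonneg n _ _

theorem continuous_weightProd (hv : Continuous v) (n m : ℕ) :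
    Continuous fun u : Fin m → ℝ => weightProd v n u :=
  continuous_finsetProd _ fun j _ => continuous_finsetSum _ fun l _ =>
    continuous_blockWeight_ends hv n l 0 j

theorem weightSum_le (hv : Continuous v) (hL : ∀ t, l1 (v t) = L) (n : ℕ) {s t : ℝ} (hst : s ≤ t) :
    weightSum v n s t ≤ divPow (2 * n) (L * (t - s)) :=
  (sum_evenTerm_le n _ _).trans (divPow_le_divPow _ (by positivity) (abs_disp_add_le hv hL hst))

theorem le_weightSum (hv : Continuous v) (n : ℕ) {s t δ c : ℝ} (hst : s ≤ t) {w : Letter → ℝ}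
    (hw : l1 w = L) (h : ∀ r ∈ Icc s t, l1 (v r - w) ≤ δ) (hc : 0 ≤ c)
    (hct : c ≤ (L - δ) * (t - s)) :
    divPow (2 * n) c / 2 ≤ weightSum v n s t := by
  refine le_trans ?_ (le_sum_evenTerm n _ _)
  have := divPow_le_divPow (2 * n) hc (hct.trans (le_abs_disp_add hv hst hw h))
  linarith

/-- The bound of the weights away from the uniform separating times. -/
def farBound (L : ℝ) (n m : ℕ) (ε : ℝ) : ℝ :=
  (divPow (2 * n) (L / ((m : ℝ) + 1)) * Real.exp (-(4 * n * ε ^ 2))) ^ (m + 1)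

/-- The block lengths form a probability vector in which `u i` is the mass of the first `i + 1`
blocks, so a displaced `u i` is what `prod_le_of_sum_far` requires; its bound is then raised to the
power `2 n`. -/
theorem weightProd_le_farBound (hv : Continuous v) (hL : ∀ t, l1 (v t) = L) (hL0 : 0 ≤ L)
    (n : ℕ) {m : ℕ} {ε : ℝ} (hε : 0 ≤ ε) {u : Fin m → ℝ} (hu : simplex 0 u) (hfar : ¬ Near ε u) :
    weightProd v n u ≤ farBound L n m ε := by
  unfold Near at hfar
  push Not at hfar
  obtain ⟨i, hi⟩ := hfar
  have hd : ∀ j, 0 ≤ rend u j - lend u j := fun j => sub_nonneg.2 (hu j)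
  have hilt := i.isLt
  have hcard : ((Finset.univ.filter fun j : Fin (m + 1) => (j : ℕ) < i + 1).card : ℝ) =
      (i : ℕ) + 1 := by
    have := sum_fin_lt (N := m + 1) (r := i + 1) (by omega) fun _ => 1
    simpa using this
  have hnode : node u (i + 1) = u i := by simp [node]
  have hp := prod_le_of_sum_far (Nat.succ_pos m) hd (sum_length u)
    (Finset.univ.filter fun j : Fin (m + 1) => (j : ℕ) < i + 1) hε (by
      rw [sum_length_lt u (by omega), hcard, hnode]
      push_cast
      exact hi)
  have h1 : weightProd v n u ≤ ∏ j, divPow (2 * n) (L * (rend u j - lend u j)) :=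
    Finset.prod_le_prod (fun j _ => weightSum_nonneg n _ _) fun j _ => weightSum_le hv hL n (hu j)
  have h2 : ∏ j, divPow (2 * n) (L * (rend u j - lend u j)) =
      ((L ^ (2 * n)) / ((2 * n).factorial : ℝ)) ^ (m + 1) *
        (∏ j, (rend u j - lend u j)) ^ (2 * n) := by
    have : ∀ j, divPow (2 * n) (L * (rend u j - lend u j)) =
        (L ^ (2 * n)) / ((2 * n).factorial : ℝ) * (rend u j - lend u j) ^ (2 * n) := by
      intro j
      unfold divPow
      rw [mul_pow]
      ring
    simp only [this]
    rw [Finset.prod_mul_distrib, Finset.prod_pow, Finset.prod_const, Finset.card_univ,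
      Fintype.card_fin]
  have h3 : (∏ j, (rend u j - lend u j)) ^ (2 * n) ≤
      ((1 / ((m : ℝ) + 1)) ^ (m + 1) * Real.exp (-(2 * ((m : ℝ) + 1) * ε ^ 2))) ^ (2 * n) := by
    refine pow_le_pow_left₀ (Finset.prod_nonneg fun j _ => hd j) ?_ _
    push_cast at hp
    exact hp
  rw [h2] at h1
  refine (h1.trans (mul_le_mul_of_nonneg_left h3 (by positivity))).trans_eq ?_
  unfold farBound divPow
  have e1 : Real.exp (-(2 * ((m : ℝ) + 1) * ε ^ 2)) ^ (2 * n) =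
      Real.exp (-(4 * n * ε ^ 2)) ^ (m + 1) := by
    rw [← Real.exp_nat_mul, ← Real.exp_nat_mul]
    congr 1
    push_cast
    ring
  rw [mul_pow _ (Real.exp _), mul_pow _ (Real.exp _), e1, ← mul_assoc, ← pow_mul,
    mul_comm (m + 1) (2 * n), pow_mul (1 / ((m : ℝ) + 1)), ← mul_pow]
  congr 2
  rw [div_pow, div_pow, one_pow]
  ring

theorem le_weightProd_of_box (hv : Continuous v) (hL : ∀ t, l1 (v t) = L) (n : ℕ) {m : ℕ}
    {δ h : ℝ} (hδ : ∀ s t, |s - t| < 1 / ((m : ℝ) + 1) → l1 (v s - v t) ≤ δ) (hδL : δ ≤ L)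
    (hh : h < 1 / (2 * ((m : ℝ) + 1))) (u : Fin m → ℝ)
    (hu : ∀ i : Fin m, u i ∈ Icc (((i : ℕ) + 1 : ℝ) / ((m : ℝ) + 1))
      (((i : ℕ) + 1 : ℝ) / ((m : ℝ) + 1) + h)) (hh0 : 0 ≤ h) :
    simplex 0 u ∧
      (divPow (2 * n) ((L - δ) * (1 / ((m : ℝ) + 1) - h)) / 2) ^ (m + 1) ≤ weightProd v n u := by
  set K : ℝ := (m : ℝ) + 1 with hK
  have hK0 : 0 < K := by positivity
  have hl : ∀ j : Fin (m + 1), lend u j ∈ Icc ((j : ℕ) / K) ((j : ℕ) / K + h) := by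
    intro j
    refine Fin.cases ?_ (fun i => ?_) j
    · simpa [lend] using hh0
    · simpa [lend] using hu i
  have hr : ∀ j : Fin (m + 1), rend u j ∈ Icc (((j : ℕ) + 1) / K) (((j : ℕ) + 1) / K + h) := by
    intro j
    refine Fin.lastCases ?_ (fun i => ?_) j
    · simp only [rend, Fin.snoc_last, Fin.val_last]
      rw [← hK, div_self hK0.ne']
      exact ⟨le_rfl, by linarith⟩
    · simpa [rend] using hu i
  have hhalf : 1 / (2 * K) = 1 / K / 2 := by rw [mul_comm, div_div]
  have hK1 : 0 < 1 / K := by positivity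
  rw [hhalf] at hh
  have hle : ∀ j, 1 / K - h ≤ rend u j - lend u j := by
    intro j
    have h1 := (hl j).2
    have h2 := (hr j).1
    rw [add_div] at h2
    linarith
  have hsimp : ∀ j, lend u j ≤ rend u j := fun j => by linarith [hle j]
  refine ⟨hsimp, ?_⟩
  have hc : ∀ j ∈ (Finset.univ : Finset (Fin (m + 1))),
      divPow (2 * n) ((L - δ) * (1 / K - h)) / 2 ≤ weightSum v n (lend u j) (rend u j) := by
    intro j _
    -- The reference velocity is taken at the midpoint of the uniform cell: the block stays within
    -- `1 / (2K) + h < 1 / K` of it, so one oscillation `δ` suffices.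
    refine le_weightSum hv n (hsimp j) (hL (((j : ℕ) + 1 / 2) / K)) (fun t ht => ?_)
      (mul_nonneg (by linarith) (by linarith))
      (mul_le_mul_of_nonneg_left (hle j) (by linarith))
    refine hδ _ _ ?_
    have h1 := (hl j).1.trans ht.1
    have h2 := ht.2.trans (hr j).2
    rw [add_div] at h2 ⊢
    rw [div_div, mul_comm 2 K, ← div_div, abs_lt]
    constructor <;> linarith
  have := Finset.prod_le_prod (fun j _ => ?_) hc
  · rwa [Finset.prod_const, Finset.card_univ, Fintype.card_fin] at this
  · have hb : 0 ≤ (L - δ) * (1 / K - h) := mul_nonneg (by linarith) (by linarith)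
    unfold divPow
    positivity

theorem sum_blockWeight_bad_le {n : ℕ} (hn : 0 < n) {s t θ r : ℝ} (hθ : 0 ≤ θ) (hst : s ≤ t)
    (hr : s < t → |direction v s t - r| ≤ θ / 2) :
    ∑ l ∈ Finset.univ.filter (fun l : Fin (n + 1) => θ < |((l : ℕ) : ℝ) / n - r|),
        blockWeight v n l s t ≤
      4 * Real.exp (-(n * θ ^ 2)) * weightSum v n s t := by
  rcases hst.eq_or_lt with rfl | hlt
  -- A degenerate block has no meaningful direction, but its weights vanish because `n > 0`.
  · have h0 : ∀ l : Fin (n + 1), blockWeight v n l s s = 0 := by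
      intro l
      have := l.isLt
      rcases Nat.eq_zero_or_pos (l : ℕ) with hl | hl
      · simp [blockWeight, shuffleMono, disp_self, divPow, hn.ne', hl]
      · simp [blockWeight, shuffleMono, disp_self, divPow, hl.ne']
    rw [Finset.sum_eq_zero fun l _ => h0 l]
    have := weightSum_nonneg (v := v) n s s
    positivity
  · have h1 := sum_evenTerm_tail_le hn (disp v 0 s t) (disp v 1 s t) 
      (by linarith : 0 ≤ θ / 2)
    rw [show 4 * (n : ℝ) * (θ / 2) ^ 2 = n * θ ^ 2 by ring] at h1
    refine le_trans ?_ h1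
    rw [Finset.sum_filter, Finset.sum_filter, Finset.sum_range]
    refine Finset.sum_le_sum fun l _ => ?_
    have hd := hr hlt
    unfold direction at hd
    by_cases hl : θ < |((l : ℕ) : ℝ) / n - r|
    · rw [if_pos hl, if_pos]
      · rfl
      · have := abs_sub_le (((l : ℕ) : ℝ) / n)
          (|disp v 0 s t| / (|disp v 0 s t| + |disp v 1 s t|)) r
        linarith
    · rw [if_neg hl]
      split_ifs
      exacts [evenTerm_nonneg _ _ _ _, le_rfl]

theorem sum_prod_eq_prod_sum {m n : ℕ} (g : Fin m → Fin (n + 1) → ℝ) :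
    ∑ l : Fin m → Fin (n + 1), ∏ j, g j (l j) = ∏ j, ∑ x, g j x := by
  rw [Finset.prod_univ_sum, Fintype.piFinset_univ]

theorem weightProd_eq_sum (n : ℕ) {m : ℕ} (u : Fin m → ℝ) :
    weightProd v n u =
      ∑ l : Fin (m + 1) → Fin (n + 1), ∏ j, blockWeight v n (l j) (lend u j) (rend u j) := by
  rw [sum_prod_eq_prod_sum fun j (x : Fin (n + 1)) => blockWeight v n x (lend u j) (rend u j)]
  exact Finset.prod_congr rfl fun j _ => Finset.sum_range _

/-- Near the uniform separating times, the multi-indices with a proportion far from the reference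
direction have a small weight. -/
theorem sum_bad_le {n : ℕ} (hn : 0 < n) {m : ℕ} {θ : ℝ} (hθ : 0 ≤ θ) (r : Fin (m + 1) → ℝ)
    {u : Fin m → ℝ} (hu : simplex 0 u)
    (hr : ∀ j, lend u j < rend u j → |direction v (lend u j) (rend u j) - r j| ≤ θ / 2) :
    ∑ l ∈ Finset.univ.filter (fun l : Fin (m + 1) → Fin (n + 1) =>
        ∃ j, θ < |((l j : ℕ) : ℝ) / n - r j|),
      ∏ j, blockWeight v n (l j) (lend u j) (rend u j) ≤
    4 * ((m : ℝ) + 1) * Real.exp (-(n * θ ^ 2)) * weightProd v n u := by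
  set W : Fin (m + 1) → Fin (n + 1) → ℝ := fun j x =>
    blockWeight v n x (lend u j) (rend u j) with hW
  have hW0 : ∀ j x, 0 ≤ W j x := fun j x => blockWeight_nonneg _ _ _ _
  -- Union bound over the offending block `i`. The indicator is written as a product over `j` so
  -- that the sum over multi-indices factorizes.
  have h1 : ∑ l ∈ Finset.univ.filter (fun l : Fin (m + 1) → Fin (n + 1) =>
        ∃ j, θ < |((l j : ℕ) : ℝ) / n - r j|), ∏ j, W j (l j) ≤
      ∑ l : Fin (m + 1) → Fin (n + 1), ∑ i, ∏ j, W j (l j) *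
        (if j = i then (if θ < |((l j : ℕ) : ℝ) / n - r j| then 1 else 0) else 1) := by
    rw [Finset.sum_filter]
    refine Finset.sum_le_sum fun l _ => ?_
    have hnn : ∀ i, 0 ≤ ∏ j, W j (l j) *
        (if j = i then (if θ < |((l j : ℕ) : ℝ) / n - r j| then (1 : ℝ) else 0) else 1) :=
      fun i => Finset.prod_nonneg fun j _ => mul_nonneg (hW0 j _) (by split_ifs <;> norm_num)
    split_ifs with h
    · obtain ⟨i, hi⟩ := h
      refine le_trans (le_of_eq ?_) (Finset.single_le_sum (fun i _ => hnn i) (Finset.mem_univ i))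
      refine Finset.prod_congr rfl fun j _ => ?_
      split_ifs with hj hj'
      · rw [mul_one]
      · exact absurd (hj ▸ hi) hj'
      · rw [mul_one]
    · exact Finset.sum_nonneg fun i _ => hnn i
  refine h1.trans ?_
  rw [Finset.sum_comm]
  have h2 : ∀ i ∈ (Finset.univ : Finset (Fin (m + 1))),
      ∑ l : Fin (m + 1) → Fin (n + 1), ∏ j, W j (l j) *
        (if j = i then (if θ < |((l j : ℕ) : ℝ) / n - r j| then 1 else 0) else 1) ≤
      4 * Real.exp (-(n * θ ^ 2)) * weightProd v n u := by
    intro i _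
    rw [sum_prod_eq_prod_sum fun j x => W j x *
        (if j = i then (if θ < |((x : ℕ) : ℝ) / n - r j| then (1 : ℝ) else 0) else 1)]
    have h3 : ∀ j ∈ (Finset.univ : Finset (Fin (m + 1))),
        ∑ x, W j x * (if j = i then
          (if θ < |((x : ℕ) : ℝ) / n - r j| then (1 : ℝ) else 0) else 1) ≤
        (if j = i then 4 * Real.exp (-(n * θ ^ 2)) else 1) *
          weightSum v n (lend u j) (rend u j) := by
      intro j _
      split_ifs with hj
      · refine le_trans (le_of_eq ?_) (sum_blockWeight_bad_le hn hθ (hu j) (hr j))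
        rw [Finset.sum_filter]
        refine Finset.sum_congr rfl fun x _ => ?_
        split_ifs <;> simp [hW]
      · simp only [mul_one, one_mul]
        exact (Finset.sum_range fun l => blockWeight v n l (lend u j) (rend u j)).ge
    refine (Finset.prod_le_prod (fun j _ => Finset.sum_nonneg fun x _ =>
      mul_nonneg (hW0 j x) (by split_ifs <;> norm_num)) h3).trans_eq ?_
    rw [Finset.prod_mul_distrib, Finset.prod_ite_eq' Finset.univ i]
    simp [weightProd]
  refine (Finset.sum_le_sum h2).trans_eq ?_
  rw [Finset.sum_const, Finset.card_univ, Fintype.card_fin, nsmul_eq_mul]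
  push_cast
  ring

/-! ### Bad mass against total mass -/

variable {γ : ℝ → Letter → ℝ}

/-- The mass of the multi-indices with `|ℓ_j / n - r_j| > θ` for some `j`. -/
def badMass (γ : ℝ → Letter → ℝ) (n m : ℕ) (θ : ℝ) (r : Fin (m + 1) → ℝ) : ℝ :=
  ∑ w : Fin m → Letter, ∑ l ∈ Finset.univ.filter (fun l : Fin (m + 1) → Fin (n + 1) =>
    ∃ j, θ < |((l j : ℕ) : ℝ) / n - r j|), |symSig γ n (m + 1) w l|

theorem abs_apply_le (hL : ∀ t, l1 (v t) = L) (t : ℝ) (i : Letter) : |v t i| ≤ L := by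
  rw [← hL t]
  exact Finset.single_le_sum (f := fun i => |v t i|) (fun _ _ => abs_nonneg _) (Finset.mem_univ i)

theorem farBound_nonneg (hL0 : 0 ≤ L) (n m : ℕ) (ε : ℝ) : 0 ≤ farBound L n m ε := by
  unfold farBound divPow
  positivity

theorem simplexInt_const_le {m : ℕ} {c : ℝ} (hc : 0 ≤ c) : simplexInt m (fun _ => c) 0 ≤ c := by
  have h := simplexInt_const_mul (m := m) c (fun _ => 1) 0
  simp only [mul_one] at h
  rw [h]
  exact mul_le_of_le_one_right hc (simplexInt_one_le ⟨le_rfl, zero_le_one⟩)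

theorem sum_prod_abs_eq (hL : ∀ t, l1 (v t) = L) {m : ℕ} (u : Fin m → ℝ) :
    ∑ w : Fin m → Letter, ∏ i, |v (u i) (w i)| = L ^ m := by
  rw [sum_prod_eq_prod_sum (n := 1) fun i (a : Fin 2) => |v (u i) a|]
  refine (Finset.prod_congr rfl fun i _ => hL (u i)).trans ?_
  simp

theorem continuous_prod_apply (hv : Continuous v) {m : ℕ} (w : Fin m → Letter) :
    Continuous fun u : Fin m → ℝ => ∏ i, v (u i) (w i) :=
  continuous_finsetProd _ fun i _ => (continuous_apply (w i)).comp (hv.comp (continuous_apply i))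

/-- Absolute values are moved inside the integral, after which the sum over `w` of the velocity
factors is exactly `L ^ m` by `sum_prod_abs_eq`. Near the uniform times `sum_bad_le` applies;
elsewhere the whole weight is at most `farBound`, on a simplex of volume at most `1`. -/
theorem badMass_le (hvc : Continuous v) (hv : ∀ t ∈ Icc (0 : ℝ) 1, v t = vel γ t)
    (hL : ∀ t, l1 (v t) = L) (hL0 : 0 ≤ L) {n m : ℕ} (hn : 0 < n) {ε θ : ℝ} (hε : 0 ≤ ε)
    (hθ : 0 ≤ θ) (r : Fin (m + 1) → ℝ)
    (hr : ∀ u : Fin m → ℝ, simplex 0 u → Near ε u → ∀ j, lend u j < rend u j →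
      |direction v (lend u j) (rend u j) - r j| ≤ θ / 2) :
    badMass γ n m θ r ≤ L ^ m * (4 * ((m : ℝ) + 1) * Real.exp (-(n * θ ^ 2)) *
      simplexInt m (weightProd v n) 0 + farBound L n m ε) := by
  set B := Finset.univ.filter (fun l : Fin (m + 1) → Fin (n + 1) =>
    ∃ j, θ < |((l j : ℕ) : ℝ) / n - r j|) with hB
  set τ := 4 * ((m : ℝ) + 1) * Real.exp (-(n * θ ^ 2)) with hτ
  set W : (Fin (m + 1) → Fin (n + 1)) → (Fin m → ℝ) → ℝ := fun l u =>
    ∏ j, blockWeight v n (l j) (lend u j) (rend u j) with hW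
  have hW0 : ∀ l u, 0 ≤ W l u := fun l u => Finset.prod_nonneg fun j _ => blockWeight_nonneg _ _ _ _
  have hWc : ∀ l, Continuous (W l) := fun l => continuous_finsetProd _ fun j _ =>
    continuous_blockWeight_ends hvc n (l j) 0 j
  have hVc : ∀ w : Fin m → Letter, Continuous fun u : Fin m → ℝ => ∏ i, |v (u i) (w i)| :=
    fun w => continuous_finsetProd _ fun i _ =>
      ((continuous_apply (w i)).comp (hvc.comp (continuous_apply i))).abs
  have hWV : ∀ l (w : Fin m → Letter),
      Continuous fun u : Fin m → ℝ => W l u * ∏ i, |v (u i) (w i)| :=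
    fun l w => (hWc l).mul (hVc w)
  have hQc := continuous_weightProd hvc n m
  have h1 : ∀ w l, |symSig γ n (m + 1) w l| ≤
      simplexInt m (fun u => W l u * ∏ i, |v (u i) (w i)|) 0 := by
    intro w l
    rw [symSig_eq_simplexInt hvc hv]
    refine abs_simplexInt_le (continuous_symIntegrand hvc _ _ _ _) (hWV l w)
      zero_le_one fun u _ => ?_
    rw [← Finset.abs_prod, ← abs_of_nonneg (hW0 l u)]
    exact (abs_mul _ _).le
  have h2 : badMass γ n m θ r ≤ simplexInt m (fun u => L ^ m * ∑ l ∈ B, W l u) 0 := by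
    calc badMass γ n m θ r ≤ ∑ w : Fin m → Letter, ∑ l ∈ B,
          simplexInt m (fun u => W l u * ∏ i, |v (u i) (w i)|) 0 :=
          Finset.sum_le_sum fun w _ => Finset.sum_le_sum fun l _ => h1 w l
      _ = simplexInt m (fun u => ∑ w : Fin m → Letter, ∑ l ∈ B,
          W l u * ∏ i, |v (u i) (w i)|) 0 := by
          rw [simplexInt_sum _ fun w _ => continuous_finsetSum _ fun l _ => hWV l w]
          exact Finset.sum_congr rfl fun w _ => (simplexInt_sum _ (fun l _ => hWV l w) _).symm
      _ = _ := by
          congr 1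
          funext u
          rw [← sum_prod_abs_eq hL u, Finset.sum_mul_sum]
          exact Finset.sum_congr rfl fun w _ => Finset.sum_congr rfl fun l _ => mul_comm _ _
  rw [simplexInt_const_mul] at h2
  refine h2.trans (mul_le_mul_of_nonneg_left ?_ (by positivity))
  have hτ0 : 0 ≤ τ := by positivity
  have hκ := farBound_nonneg hL0 n m ε
  have hτ1 : ∀ u : Fin m → ℝ, simplex 0 u →
      ∑ l ∈ B, W l u ≤ τ * weightProd v n u - -farBound L n m ε := by
    intro u hu
    have hQ := weightProd_nonneg (v := v) n u
    rw [sub_neg_eq_add]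
    by_cases hnear : Near ε u
    · have := sum_bad_le hn hθ r hu (hr u hu hnear)
      linarith
    · have h3 := weightProd_le_farBound hvc hL hL0 n hε hu hnear
      have h4 : ∑ l ∈ B, W l u ≤ weightProd v n u := by
        rw [weightProd_eq_sum]
        exact Finset.sum_le_sum_of_subset_of_nonneg (Finset.filter_subset _ _)
          fun l _ _ => hW0 l u
      have := mul_nonneg hτ0 hQ
      linarith
  have h5 := simplexInt_mono (f := fun u => ∑ l ∈ B, W l u)
    (g := fun u => τ * weightProd v n u - -farBound L n m ε)
    (continuous_finsetSum _ fun l _ => hWc l)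
    ((hQc.const_mul τ).sub continuous_const) zero_le_one hτ1
  rw [simplexInt_sub (hQc.const_mul τ) continuous_const, simplexInt_const_mul] at h5
  have h6 : simplexInt m (fun _ => -farBound L n m ε) 0 =
      -simplexInt m (fun _ => farBound L n m ε) 0 := by
    simpa using simplexInt_const_mul (m := m) (-1) (fun _ => farBound L n m ε) 0
  have h7 := simplexInt_const_le (m := m) hκ
  rw [h6] at h5
  exact h5.trans (by linarith)

/-- A single word `w` suffices: summing `symSig` over `ℓ` without absolute values gives the integral
of the full weight times the velocity factor, whose sign is fixed near the uniform times. Far away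
the sign is unknown; the integrand there and the main term subtracted there each cost at most `L ^ m
* farBound`, whence the factor `2`. -/
theorem le_totalMass (hvc : Continuous v) (hv : ∀ t ∈ Icc (0 : ℝ) 1, v t = vel γ t)
    (hL : ∀ t, l1 (v t) = L) (hL0 : 0 ≤ L) (n : ℕ) {m : ℕ} {ε : ℝ} (hε : 0 ≤ ε)
    (w : Fin m → Letter) (σ : Fin m → ℝ) (hσ : ∀ i, |σ i| = 1)
    (hw : ∀ u : Fin m → ℝ, simplex 0 u → Near ε u → ∀ i, L / 4 ≤ σ i * v (u i) (w i)) :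
    (L / 4) ^ m * simplexInt m (weightProd v n) 0 - 2 * L ^ m * farBound L n m ε ≤
      totalMass γ n (m + 1) := by
  set s : ℝ := ∏ i, σ i with hs
  have hs1 : |s| = 1 := by
    rw [hs, Finset.abs_prod]
    exact Finset.prod_eq_one fun i _ => hσ i
  have hκ := farBound_nonneg hL0 n m ε
  have hQc := continuous_weightProd hvc n m
  have hVc := continuous_prod_apply hvc w
  have h1 : simplexInt m (fun u => s * ((∏ i, v (u i) (w i)) * weightProd v n u)) 0 ≤
      totalMass γ n (m + 1) := by
    rw [simplexInt_const_mul]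
    have h2 : simplexInt m (fun u => (∏ i, v (u i) (w i)) * weightProd v n u) 0 =
        ∑ l : Fin (m + 1) → Fin (n + 1), symSig γ n (m + 1) w l := by
      simp only [symSig_eq_simplexInt hvc hv]
      rw [← simplexInt_sum _ fun l _ => continuous_symIntegrand hvc _ _ _ _]
      congr 1
      funext u
      rw [weightProd_eq_sum, Finset.mul_sum]
      exact Finset.sum_congr rfl fun l _ => mul_comm _ _
    rw [h2]
    refine (le_abs_self _).trans ?_
    rw [abs_mul, hs1, one_mul]
    refine (Finset.abs_sum_le_sum_abs _ _).trans ?_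
    exact Finset.single_le_sum (f := fun w : Fin m → Letter =>
      ∑ l : Fin (m + 1) → Fin (n + 1), |symSig γ n (m + 1) w l|)
      (fun w _ => Finset.sum_nonneg fun l _ => abs_nonneg _) (Finset.mem_univ w)
  refine le_trans ?_ h1
  have hpt : ∀ u : Fin m → ℝ, simplex 0 u →
      (L / 4) ^ m * weightProd v n u - 2 * L ^ m * farBound L n m ε ≤
        s * ((∏ i, v (u i) (w i)) * weightProd v n u) := by
    intro u hu
    have hQ := weightProd_nonneg (v := v) n u
    have hprod : s * ∏ i, v (u i) (w i) = ∏ i, σ i * v (u i) (w i) := by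
      rw [hs, Finset.prod_mul_distrib]
    rw [← mul_assoc, hprod]
    by_cases hnear : Near ε u
    · have h3 : (L / 4) ^ m ≤ ∏ i, σ i * v (u i) (w i) := by
        have := Finset.prod_le_prod (s := Finset.univ) (f := fun _ : Fin m => L / 4)
          (fun _ _ => by positivity) fun i _ => hw u hu hnear i
        rwa [Finset.prod_const, Finset.card_univ, Fintype.card_fin] at this
      have h4 := mul_le_mul_of_nonneg_right h3 hQ
      have h5 : 0 ≤ 2 * L ^ m * farBound L n m ε := by positivity
      linarith
    · have h3 := weightProd_le_farBound hvc hL hL0 n hε hu hnear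
      have h4 : |∏ i, σ i * v (u i) (w i)| ≤ L ^ m := by
        rw [Finset.abs_prod]
        have := Finset.prod_le_prod (s := Finset.univ)
          (f := fun i : Fin m => |σ i * v (u i) (w i)|) (g := fun _ => L)
          (fun _ _ => abs_nonneg _) fun i _ => by
            rw [abs_mul, hσ, one_mul]
            exact abs_apply_le hL _ _
        simpa using this
      have h5 := mul_le_mul_of_nonneg_right (neg_le_of_abs_le h4) hQ
      have h6 : (L / 4) ^ m ≤ L ^ m := pow_le_pow_left₀ (by positivity) (by linarith) m
      have h7 := mul_le_mul_of_nonneg_right h6 hQ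
      have h8 := mul_le_mul_of_nonneg_left h3 (pow_nonneg hL0 m)
      linarith
  have h9 := simplexInt_mono
    (f := fun u => (L / 4) ^ m * weightProd v n u - 2 * L ^ m * farBound L n m ε)
    (g := fun u => s * ((∏ i, v (u i) (w i)) * weightProd v n u))
    ((hQc.const_mul _).sub continuous_const)
    ((hVc.mul hQc).const_mul s) zero_le_one hpt
  rw [simplexInt_sub (hQc.const_mul _) continuous_const, simplexInt_const_mul] at h9
  have h10 := simplexInt_const_le (m := m)
    (c := 2 * L ^ m * farBound L n m ε) (by positivity)
  linarith

/-- If the far region and the tails are negligible, the bad multi-indices carry less than half of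
the total mass. -/
theorem badMass_lt_of_small {bad total A κ τ L : ℝ} {m : ℕ} (hL0 : 0 < L) (hA : 0 < A)
    (hbad : bad ≤ L ^ m * (τ * A + κ)) (htotal : (L / 4) ^ m * A - 2 * L ^ m * κ ≤ total)
    (hτ : τ ≤ (1 / 4) ^ m / 8) (hκ : κ ≤ (1 / 4) ^ m / 16 * A) : bad < total / 2 := by
  have hP : 0 < L ^ m := by positivity
  have hq : (0 : ℝ) < (1 / 4) ^ m := by positivity
  have h4 : (L / 4) ^ m = L ^ m * (1 / 4) ^ m := by rw [← mul_pow]; congr 1; ring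
  rw [h4] at htotal
  have h1 := mul_le_mul_of_nonneg_right hτ hA.le
  -- In units of `L ^ m * (1 / 4) ^ m * A`, the bad mass is at most `1/8 + 1/16 = 3/16` and the
  -- total at least `1 - 2/16 = 7/8`.
  have h2 : L ^ m * (τ * A + κ) ≤ L ^ m * (3 / 16 * ((1 / 4) ^ m * A)) :=
    mul_le_mul_of_nonneg_left (by linarith) hP.le
  have h3 := mul_le_mul_of_nonneg_left hκ hP.le
  have h5 : 0 < L ^ m * ((1 / 4) ^ m * A) := by positivity
  linarith

/-! ### The velocity and its modulus of continuity -/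

theorem l1_add_le (a b : Letter → ℝ) : l1 (a + b) ≤ l1 a + l1 b := by
  unfold l1
  rw [← Finset.sum_add_distrib]
  exact Finset.sum_le_sum fun i _ => abs_add_le _ _

theorem l1_nonneg (a : Letter → ℝ) : 0 ≤ l1 a := Finset.sum_nonneg fun _ _ => abs_nonneg _

theorem abs_le_l1 (a : Letter → ℝ) (i : Letter) : |a i| ≤ l1 a :=
  Finset.single_le_sum (f := fun i => |a i|) (fun _ _ => abs_nonneg _) (Finset.mem_univ i)

theorem l1_sub_le (a b : Letter → ℝ) : l1 (a - b) ≤ l1 a + l1 b := by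
  have h : l1 (-b) = l1 b := by simp [l1]
  rw [sub_eq_add_neg, ← h]
  exact l1_add_le _ _

theorem l1_le_of_dist_le {a b : Letter → ℝ} {e : ℝ} (h : dist a b ≤ e) : l1 (a - b) ≤ 2 * e := by
  rw [l1_eq]
  have h0 := (dist_le_pi_dist a b 0).trans h
  have h1 := (dist_le_pi_dist a b 1).trans h
  rw [Real.dist_eq] at h0 h1
  simp only [Pi.sub_apply]
  linarith

/-- The velocity of a path on `[0,1]`, extended to `ℝ` by its values at the end points. -/
def extVel (γ : ℝ → Letter → ℝ) (t : ℝ) : Letter → ℝ := vel γ (projIcc 0 1 zero_le_one t)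

theorem extVel_eq {t : ℝ} (ht : t ∈ Icc (0 : ℝ) 1) : extVel γ t = vel γ t := by
  unfold extVel
  rw [projIcc_of_mem _ ht]

theorem continuousOn_vel (hγ : ContDiffOn ℝ 1 γ (Icc 0 1)) : ContinuousOn (vel γ) (Icc 0 1) :=
  hγ.continuousOn_derivWithin (uniqueDiffOn_Icc zero_lt_one) le_rfl

theorem continuous_extVel (hγ : ContDiffOn ℝ 1 γ (Icc 0 1)) : Continuous (extVel γ) :=
  (continuousOn_iff_continuous_domRestrict.1 (continuousOn_vel hγ)).comp continuous_projIcc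

theorem l1_extVel (hL : ∀ t ∈ Icc (0 : ℝ) 1, l1 (vel γ t) = L) (t : ℝ) : l1 (extVel γ t) = L :=
  hL _ (projIcc 0 1 zero_le_one t).2

theorem disp_extVel (hγ : ContDiffOn ℝ 1 γ (Icc 0 1)) (i : Letter) {a b : ℝ} (ha : 0 ≤ a)
    (hab : a ≤ b) (hb : b ≤ 1) : disp (extVel γ) i a b = γ b i - γ a i := by
  refine intervalIntegral.integral_eq_sub_of_hasDerivAt_of_le (f := fun t => γ t i) hab ?_
    (fun t ht => ?_)
    (intervalIntegrable_apply (continuous_extVel hγ) i a b)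
  · exact (continuous_apply i).comp_continuousOn (hγ.continuousOn.mono (Icc_subset_Icc ha hb))
  · have ht01 : t ∈ Ioo (0 : ℝ) 1 := ⟨ha.trans_lt ht.1, ht.2.trans_le hb⟩
    have hd : HasDerivAt γ (vel γ t) t :=
      ((hγ.differentiableOn one_ne_zero t (Ioo_subset_Icc_self ht01)).hasDerivWithinAt).hasDerivAt
        (Icc_mem_nhds ht01.1 ht01.2)
    rw [extVel_eq (Ioo_subset_Icc_self ht01)]
    exact hasDerivAt_pi.1 hd i

theorem trueDir_eq_direction (hγ : ContDiffOn ℝ 1 γ (Icc 0 1)) (m : ℕ) (j : Fin (m + 1)) :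
    trueDir γ (m + 1) j =
      direction (extVel γ) ((j : ℕ) / ((m : ℝ) + 1)) (((j : ℕ) + 1) / ((m : ℝ) + 1)) := by
  have hK : (0 : ℝ) < (m : ℝ) + 1 := by positivity
  have hj : ((j : ℕ) : ℝ) + 1 ≤ (m : ℝ) + 1 := by exact_mod_cast j.isLt
  have h : ∀ i, incr γ (m + 1) j i =
      disp (extVel γ) i ((j : ℕ) / ((m : ℝ) + 1)) (((j : ℕ) + 1) / ((m : ℝ) + 1)) := by
    intro i
    rw [disp_extVel hγ i (by positivity) (by gcongr; linarith) (by rw [div_le_one hK]; exact hj)]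
    simp [incr]
  unfold trueDir direction
  rw [h, h]

theorem l1_extVel_sub_le_delta (hL : ∀ t ∈ Icc (0 : ℝ) 1, l1 (vel γ t) = L) {κ s t : ℝ}
    (h : |s - t| < 1 / κ) : l1 (extVel γ s - extVel γ t) ≤ delta γ κ := by
  refine le_csSup ⟨L + L, ?_⟩ ⟨_, (projIcc 0 1 zero_le_one s).2, _,
    (projIcc 0 1 zero_le_one t).2, ?_, rfl⟩
  · rintro d ⟨s, hs, t, ht, -, rfl⟩
    exact (l1_sub_le _ _).trans_eq (by rw [hL s hs, hL t ht])
  · exact (abs_projIcc_sub_projIcc zero_le_one).trans_lt h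

theorem delta_nonneg (κ : ℝ) : 0 ≤ delta γ κ := by
  refine Real.sSup_nonneg ?_
  rintro d ⟨s, -, t, -, -, rfl⟩
  exact l1_nonneg _

theorem tendsto_delta (hγ : ContDiffOn ℝ 1 γ (Icc 0 1)) {κ : ℕ → ℝ}
    (hκ : Tendsto (fun k => 1 / κ k) atTop (nhds 0)) :
    Tendsto (fun k => delta γ (κ k)) atTop (nhds 0) := by
  rw [Metric.tendsto_atTop]
  intro e he
  obtain ⟨d, hd, hunif⟩ := Metric.uniformContinuousOn_iff.1
    (isCompact_Icc.uniformContinuousOn_of_continuous (continuousOn_vel hγ)) (e / 4) (by positivity)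
  obtain ⟨N, hN⟩ := eventually_atTop.1 (hκ.eventually (gt_mem_nhds hd))
  refine ⟨N, fun k hk => ?_⟩
  rw [Real.dist_eq, sub_zero, abs_of_nonneg (delta_nonneg _)]
  refine lt_of_le_of_lt (Real.sSup_le (a := 2 * (e / 4)) ?_ (by positivity)) (by linarith)
  rintro x ⟨s, hs, t, ht, hst, rfl⟩
  exact l1_le_of_dist_le (hunif s hs t ht (hst.trans (hN k hk))).le

theorem tendsto_delta_nat (hγ : ContDiffOn ℝ 1 γ (Icc 0 1)) :
    Tendsto (fun k : ℕ => delta γ k) atTop (nhds 0) :=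
  tendsto_delta hγ tendsto_one_div_atTop_nhds_zero_nat

theorem tendsto_eps (hγ : ContDiffOn ℝ 1 γ (Icc 0 1)) (L : ℝ) :
    Tendsto (eps γ L) atTop (nhds 0) := by
  have h1 := ((tendsto_delta_nat hγ).div_const L).sqrt
  have h2 := (tendsto_one_div_atTop_nhds_zero_nat (𝕜 := ℝ)).sqrt
  have h3 := h1.add h2
  simp only [zero_div, Real.sqrt_zero, add_zero] at h3
  exact h3

theorem tendsto_eta (hγ : ContDiffOn ℝ 1 γ (Icc 0 1)) (L : ℝ) :
    Tendsto (eta γ L) atTop (nhds 0) := by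
  refine tendsto_delta hγ ?_
  simpa using (tendsto_eps hγ L).const_mul 3

/-- The modulus of continuity grows at most linearly. -/
theorem l1_sub_le_nat_mul {v : ℝ → Letter → ℝ} {h η : ℝ}
    (hη : ∀ s t, |s - t| ≤ h → l1 (v s - v t) ≤ η) (N : ℕ) {s t : ℝ}
    (hst : |s - t| ≤ N * h) : l1 (v s - v t) ≤ N * η := by
  induction N generalizing s t with
  | zero =>
    have : s - t = 0 := by simpa using hst
    rw [sub_eq_zero.1 this]
    simp [l1]
  | succ N ih =>
    push_cast at hst
    have hN : (0 : ℝ) < (N : ℝ) + 1 := by positivity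
    have hle : |s - t| / (N + 1) ≤ h := by
      rw [div_le_iff₀ hN]
      linarith
    set r : ℝ := t + (s - t) / (N + 1) with hr
    have h1 : |r - t| ≤ h := by
      rw [hr, add_sub_cancel_left, abs_div, abs_of_pos hN]
      exact hle
    have h2 : |s - r| ≤ N * h := by
      have : s - r = N * ((s - t) / (N + 1)) := by
        rw [hr]
        field_simp
        ring
      rw [this, abs_mul, Nat.abs_cast, abs_div, abs_of_pos hN]
      gcongr
    have h3 := l1_add_le (v s - v r) (v r - v t)
    rw [sub_add_sub_cancel] at h3
    push_cast
    linarith [ih h2, hη r t h1]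

theorem sqrt_one_div_le_eps (L : ℝ) (k : ℕ) : √(1 / (k : ℝ)) ≤ eps γ L k :=
  le_add_of_nonneg_left (Real.sqrt_nonneg _)

theorem l1_extVel_sub_le_eta (hL : ∀ t ∈ Icc (0 : ℝ) 1, l1 (vel γ t) = L) {k : ℕ} {s t : ℝ}
    (h : |s - t| < 3 * eps γ L k) : l1 (extVel γ s - extVel γ t) ≤ eta γ L k :=
  l1_extVel_sub_le_delta hL (by rwa [one_div_one_div])

/-- The oscillation of a non-constant velocity at the scale `ε_k` is at least of order
`1 / √k`. -/
theorem exists_le_eta_sq (hL : ∀ t ∈ Icc (0 : ℝ) 1, l1 (vel γ t) = L)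
    (hne : ∃ s ∈ Icc (0 : ℝ) 1, ∃ t ∈ Icc (0 : ℝ) 1, vel γ s ≠ vel γ t) :
    ∃ c : ℝ, 0 < c ∧ ∀ k : ℕ, 0 < k → c / k ≤ eta γ L k ^ 2 := by
  obtain ⟨s, hs, t, ht, hst⟩ := hne
  set D := l1 (vel γ s - vel γ t) with hD
  have hD0 : 0 < D := by
    obtain ⟨i, hi⟩ := Function.ne_iff.1 hst
    exact (abs_pos.2 (sub_ne_zero.2 hi)).trans_le (abs_le_l1 (vel γ s - vel γ t) i)
  refine ⟨D ^ 2 / 4, by positivity, fun k hk => ?_⟩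
  have hk' : (1 : ℝ) ≤ k := by exact_mod_cast hk
  -- The least `N` with `N² > k`: then `1 / N < √(1/k) ≤ ε_k`, so `N` steps of that scale cross
  -- `[0,1]` and `D ≤ N η`. The constant `D² / 4` comes from `N² ≤ 4 k`.
  set N : ℕ := Nat.sqrt k + 1 with hN
  have hN0 : (0 : ℝ) < N := by positivity
  have hNk : (k : ℝ) < (N : ℝ) ^ 2 := by
    have := Nat.lt_succ_sqrt' k
    exact_mod_cast this
  have hN2 : (N : ℝ) ^ 2 ≤ 4 * k := by
    have h1 : Nat.sqrt k * Nat.sqrt k ≤ k := Nat.sqrt_le k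
    have h2 : 1 ≤ Nat.sqrt k := Nat.sqrt_pos.2 hk
    have h3 : N ^ 2 ≤ 4 * k := by
      rw [hN]
      nlinarith
    exact_mod_cast h3
  have hscale : 1 / (N : ℝ) < 3 * eps γ L k := by
    have h1 : 1 / (N : ℝ) < √(1 / (k : ℝ)) := by
      apply Real.lt_sqrt_of_sq_lt
      rw [div_pow, one_pow]
      exact one_div_lt_one_div_of_lt (by linarith) hNk
    have h2 := sqrt_one_div_le_eps (γ := γ) L k
    have h3 : 0 < 1 / (N : ℝ) := by positivity
    linarith
  have h := l1_sub_le_nat_mul (v := extVel γ) (h := 1 / N) (η := eta γ L k)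
    (fun s t h => l1_extVel_sub_le_eta hL (h.trans_lt hscale)) N (s := s) (t := t) (by
      rw [mul_one_div_cancel hN0.ne', abs_le]
      constructor <;> linarith [hs.1, hs.2, ht.1, ht.2])
  rw [extVel_eq hs, extVel_eq ht, ← hD] at h
  have h2 : D ^ 2 ≤ (N : ℝ) ^ 2 * eta γ L k ^ 2 := by
    rw [← mul_pow]
    exact pow_le_pow_left₀ hD0.le h 2
  rw [div_le_iff₀ (by linarith)]
  nlinarith [sq_nonneg (eta γ L k)]

/-! ### Quantitative smallness from the growth of `n` -/

/-- Turns the relative losses `1 - δ / L` and `1 - 1 / K ^ 2` of the box into exponentials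
comparable with `farBound`. -/
theorem exp_neg_two_mul_le {x : ℝ} (h0 : 0 ≤ x) (h : x ≤ 1 / 2) : Real.exp (-(2 * x)) ≤ 1 - x := by
  rw [Real.exp_neg, inv_le_iff_one_le_mul₀ (Real.exp_pos _)]
  have h1 := Real.add_one_le_exp (2 * x)
  nlinarith

/-- The far region is negligible against a small box around the uniform separating times. -/
theorem farBound_le {n m : ℕ} {δ ε : ℝ} (hL0 : 0 < L) (hm : 2 ≤ (m : ℝ) + 1) (hδ0 : 0 ≤ δ)
    (hδ : δ ≤ L / 2) (hε : δ / L + 1 / ((m : ℝ) + 1) ≤ ε ^ 2)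
    (hn : 128 * ((m : ℝ) + 1) ^ 3 ≤
      Real.exp (4 * n / ((m : ℝ) + 1) - 4 * n / ((m : ℝ) + 1) ^ 2)) :
    farBound L n m ε ≤ (1 / 4) ^ m / 16 * ((1 / ((m : ℝ) + 1) ^ 3) ^ m *
      (divPow (2 * n) ((L - δ) * (1 / ((m : ℝ) + 1) - 1 / ((m : ℝ) + 1) ^ 3)) / 2) ^ (m + 1)) := by
  set K : ℝ := (m : ℝ) + 1 with hK
  have hK0 : 0 < K := by linarith
  set y : ℝ := Real.exp (-(2 * (δ / L)) + -(2 * (1 / K ^ 2))) with hy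
  have hy1 : L / K * y ≤ (L - δ) * (1 / K - 1 / K ^ 3) := by
    have e1 := exp_neg_two_mul_le (x := δ / L) (by positivity)
      (by rw [div_le_iff₀ hL0]; linarith)
    have e2 := exp_neg_two_mul_le (x := 1 / K ^ 2) (by positivity)
      (by rw [div_le_div_iff₀ (by positivity) (by norm_num)]; nlinarith)
    have e3 : y ≤ (1 - δ / L) * (1 - 1 / K ^ 2) := by
      rw [hy, Real.exp_add]
      exact mul_le_mul e1 e2 (Real.exp_pos _).le ((Real.exp_pos _).le.trans e1)
    have e4 : (L - δ) * (1 / K - 1 / K ^ 3) = L / K * ((1 - δ / L) * (1 - 1 / K ^ 2)) := by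
      field_simp
    rw [e4]
    exact mul_le_mul_of_nonneg_left e3 (by positivity)
  set P : ℝ := divPow (2 * n) (L / K) with hP
  have hP0 : 0 ≤ P := divPow_even_nonneg n _
  set c : ℝ := divPow (2 * n) ((L - δ) * (1 / K - 1 / K ^ 3)) / 2 with hc
  have hcle : P * Real.exp (-(4 * n * (δ / L)) - 4 * n / K ^ 2) / 2 ≤ c := by
    have h1 := divPow_le_divPow (2 * n) (by positivity : 0 ≤ L / K * y) hy1
    have h2 : divPow (2 * n) (L / K * y) =
        P * Real.exp (-(4 * n * (δ / L)) - 4 * n / K ^ 2) := by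
      rw [hP]
      unfold divPow
      rw [mul_pow, hy, ← Real.exp_nat_mul, div_mul_eq_mul_div]
      congr 3
      push_cast
      ring
    rw [h2] at h1
    linarith
  have hc0 : 0 ≤ c := le_trans (by positivity) hcle
  -- The comparison for one block. The part `δ / L` of `ε²` pays for the oscillation, the part `1 /
  -- K` leaves the surplus `exp (4n/K - 4n/K²)`. That covers `128 K³`: `K³` for one side of the box,
  -- `2` for the halved weight in `c`, and `64 = 4 * 16` for the constants of the conclusion.
  have hmain : P * Real.exp (-(4 * n * ε ^ 2)) ≤ 1 / 64 * (1 / K ^ 3) * c := by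
    have h1 : Real.exp (-(4 * n * ε ^ 2)) ≤
        Real.exp (-(4 * n * (δ / L)) - 4 * n / K ^ 2) *
          Real.exp (-(4 * n / K - 4 * n / K ^ 2)) := by
      rw [← Real.exp_add, Real.exp_le_exp]
      have h2 := mul_le_mul_of_nonneg_left hε (by positivity : (0 : ℝ) ≤ 4 * n)
      have h3 : 4 * (n : ℝ) * (δ / L + 1 / K) = 4 * n * (δ / L) + 4 * n / K := by ring
      linarith
    have h2 : Real.exp (-(4 * n / K - 4 * n / K ^ 2)) ≤ 1 / (128 * K ^ 3) := by
      rw [Real.exp_neg, ← one_div]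
      exact one_div_le_one_div_of_le (by positivity) hn
    calc P * Real.exp (-(4 * n * ε ^ 2))
        ≤ P * (Real.exp (-(4 * n * (δ / L)) - 4 * n / K ^ 2) * (1 / (128 * K ^ 3))) := by
          refine mul_le_mul_of_nonneg_left (h1.trans ?_) hP0
          exact mul_le_mul_of_nonneg_left h2 (Real.exp_pos _).le
      _ = 1 / 64 * (1 / K ^ 3) * (P * Real.exp (-(4 * n * (δ / L)) - 4 * n / K ^ 2) / 2) := by
          field_simp
          ring
      _ ≤ _ := mul_le_mul_of_nonneg_left hcle (by positivity)
  have hh : 1 / K ^ 3 ≤ 1 := by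
    rw [div_le_one (by positivity)]
    exact one_le_pow₀ (by linarith)
  calc farBound L n m ε = (P * Real.exp (-(4 * n * ε ^ 2))) ^ (m + 1) := rfl
    _ ≤ (1 / 64 * (1 / K ^ 3) * c) ^ (m + 1) := pow_le_pow_left₀ (by positivity) hmain _
    _ = (1 / 4) ^ (m + 1) * (1 / 16) ^ (m + 1) * ((1 / K ^ 3) ^ (m + 1) * c ^ (m + 1)) := by
        rw [← mul_pow, ← mul_pow, ← mul_pow]
        congr 1
        ring
    _ ≤ (1 / 4) ^ m * (1 / 16) * ((1 / K ^ 3) ^ m * c ^ (m + 1)) := by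
        have e1 : (1 / 4 : ℝ) ^ (m + 1) ≤ (1 / 4) ^ m :=
          pow_le_pow_of_le_one (by norm_num) (by norm_num) (Nat.le_succ m)
        have e2 : (1 / 16 : ℝ) ^ (m + 1) ≤ 1 / 16 :=
          pow_le_of_le_one (by norm_num) (by norm_num) (Nat.succ_ne_zero m)
        have e3 : (1 / K ^ 3) ^ (m + 1) ≤ (1 / K ^ 3) ^ m :=
          pow_le_pow_of_le_one (by positivity) hh (Nat.le_succ m)
        exact mul_le_mul (mul_le_mul e1 e2 (by positivity) (by positivity))
          (mul_le_mul_of_nonneg_right e3 (by positivity)) (by positivity) (by positivity)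
    _ = _ := by ring

/-- The growth of `n` makes the far region negligible. -/
theorem le_exp_of_growth {n : ℕ} {K : ℝ} (hK : 8 ≤ K) (hn : K ^ 2 * Real.log K - 1 < n) :
    128 * K ^ 3 ≤ Real.exp (4 * n / K - 4 * n / K ^ 2) := by
  have hK0 : 0 < K := by linarith
  have hlog : 1 ≤ Real.log K := by
    rw [Real.le_log_iff_exp_le hK0]
    linarith [Real.exp_one_lt_d9]
  have h128 : (128 : ℝ) ≤ Real.exp 5 := by
    have h1 := Real.exp_one_gt_d9
    have h2 : Real.exp 5 = Real.exp 1 ^ 5 := by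
      rw [← Real.exp_nat_mul]
      norm_num
    rw [h2]
    calc (128 : ℝ) ≤ 2.7 ^ 5 := by norm_num
      _ ≤ _ := pow_le_pow_left₀ (by norm_num) (by linarith) 5
  have hK3 : K ^ 3 = Real.exp (3 * Real.log K) := by
    rw [mul_comm, Real.exp_mul, Real.exp_log hK0]
    norm_num
  rw [hK3]
  refine (mul_le_mul_of_nonneg_right h128 (Real.exp_pos _).le).trans ?_
  rw [← Real.exp_add, Real.exp_le_exp]
  have h1 : 4 * (n : ℝ) / K - 4 * n / K ^ 2 = 4 * n * (K - 1) / K ^ 2 := by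
    field_simp
  rw [h1, le_div_iff₀ (by positivity)]
  have h2 : (5 + 3 * Real.log K) * K ^ 2 ≤ 4 * (K ^ 2 * Real.log K - 1) * (K - 1) := by
    have h3 : 0 ≤ K ^ 2 * (Real.log K - 1) := by
      have := sub_nonneg.2 hlog
      positivity
    have h4 : K ^ 2 * Real.log K * (4 * (K - 1) - 3) ≥ K ^ 2 * (4 * (K - 1) - 3) := by
      nlinarith
    nlinarith
  refine h2.trans ?_
  nlinarith

/-- The growth of `n` makes the tails of the blocks negligible. -/
theorem tail_le_of_growth {n m : ℕ} {a θ : ℝ} (ha : 0 < a)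
    (hlog : 7 / a + 1 ≤ Real.log ((m : ℝ) + 1))
    (hn : ((m : ℝ) + 1) ^ 2 * Real.log ((m : ℝ) + 1) - 1 < n)
    (hθ : a / ((m : ℝ) + 1) ≤ θ ^ 2) :
    4 * ((m : ℝ) + 1) * Real.exp (-(n * θ ^ 2)) ≤ (1 / 4) ^ m / 8 := by
  set K : ℝ := (m : ℝ) + 1 with hK
  have hK1 : 1 ≤ K := by rw [hK]; linarith [(Nat.cast_nonneg m : (0 : ℝ) ≤ m)]
  -- Since `n θ²` is at least `a K log K - a / K`, the threshold `7 / a + 1` for the logarithm gives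
  -- `7 K`; the summand `1` absorbs `a / K`. The multiple `7` is ample, as `32 K 4^m ≤ exp (4 + K +
  -- 2 m)`.
  have h7 : 7 * K ≤ n * θ ^ 2 := by
    have h1 : (n : ℝ) * (a / K) ≤ n * θ ^ 2 := mul_le_mul_of_nonneg_left hθ (by positivity)
    have h2 : (K ^ 2 * Real.log K - 1) * (a / K) ≤ n * (a / K) :=
      mul_le_mul_of_nonneg_right hn.le (by positivity)
    have h3 : (K ^ 2 * Real.log K - 1) * (a / K) = a * K * Real.log K - a / K := by
      field_simp
    have h4 : a * K * (7 / a + 1) ≤ a * K * Real.log K :=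
      mul_le_mul_of_nonneg_left hlog (by positivity)
    have h5 : a * K * (7 / a + 1) = 7 * K + a * K := by
      field_simp
    have h6 : a / K ≤ a := div_le_self ha.le hK1
    nlinarith
  have e1 : Real.exp (-(n * θ ^ 2)) ≤ Real.exp (-(7 * K)) := Real.exp_le_exp.2 (by linarith)
  have h2 := Real.exp_one_gt_d9
  have h32 : (32 : ℝ) ≤ Real.exp 4 := by
    have : Real.exp 4 = Real.exp 1 ^ 4 := by
      rw [← Real.exp_nat_mul]
      norm_num
    rw [this]
    calc (32 : ℝ) ≤ 2.7 ^ 4 := by norm_num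
      _ ≤ _ := pow_le_pow_left₀ (by norm_num) (by linarith) 4
  have h4m : (4 : ℝ) ^ m ≤ Real.exp (2 * m) := by
    have : Real.exp (2 * m) = (Real.exp 1 ^ 2) ^ m := by
      rw [← pow_mul, ← Real.exp_nat_mul]
      push_cast
      ring_nf
    rw [this]
    refine pow_le_pow_left₀ (by norm_num) ?_ m
    nlinarith
  have hKe : K ≤ Real.exp K := by linarith [Real.add_one_le_exp K]
  have hall : 32 * K * 4 ^ m ≤ Real.exp (7 * K) := by
    calc 32 * K * 4 ^ m ≤ Real.exp 4 * Real.exp K * Real.exp (2 * m) := by gcongr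
      _ = Real.exp (4 + K + 2 * m) := by rw [Real.exp_add (4 + K), Real.exp_add 4]
      _ ≤ _ := Real.exp_le_exp.2 (by rw [hK] at hK1 ⊢; linarith)
  calc 4 * K * Real.exp (-(n * θ ^ 2)) ≤ 4 * K * Real.exp (-(7 * K)) := by gcongr
    _ ≤ (1 / 4) ^ m / 8 := by
        rw [Real.exp_neg, ← div_eq_mul_inv, div_le_iff₀ (Real.exp_pos _), one_div, inv_pow]
        have h4p : (0 : ℝ) < 4 ^ m := by positivity
        rw [div_mul_eq_mul_div, inv_mul_eq_div, div_div, le_div_iff₀ (by positivity)]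
        linarith

/-! ### Comparison with the true directions and conclusion -/

theorem exists_dominant_letter (x : Letter → ℝ) :
    ∃ (i : Letter) (σ : ℝ), |σ| = 1 ∧ l1 x / 2 ≤ σ * x i := by
  have hσ : ∀ y : ℝ, ∃ σ : ℝ, |σ| = 1 ∧ |y| = σ * y := by
    intro y
    rcases le_total 0 y with h | h
    · exact ⟨1, by simp, by rw [abs_of_nonneg h, one_mul]⟩
    · exact ⟨-1, by simp, by rw [abs_of_nonpos h, neg_one_mul]⟩
  have hx := l1_eq x
  rcases le_total |x 1| |x 0| with h | h
  · obtain ⟨σ, h1, h2⟩ := hσ (x 0)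
    exact ⟨0, σ, h1, by linarith⟩
  · obtain ⟨σ, h1, h2⟩ := hσ (x 1)
    exact ⟨1, σ, h1, by linarith⟩

/-- The square of a sum of two roots dominates the sum of the radicands, which is the exponent that
`farBound_le` needs; this explains the form of `ε_k`. -/
theorem le_eps_sq (γ : ℝ → Letter → ℝ) (hL0 : 0 < L) (m : ℕ) :
    delta γ ((m + 1 : ℕ) : ℝ) / L + 1 / ((m : ℝ) + 1) ≤ eps γ L (m + 1) ^ 2 := by
  unfold eps
  have h1 := Real.sq_sqrt (div_nonneg (delta_nonneg (γ := γ) ((m + 1 : ℕ) : ℝ)) hL0.le)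
  have h2 := Real.sq_sqrt (by positivity : (0 : ℝ) ≤ 1 / ((m + 1 : ℕ) : ℝ))
  have h3 : 0 ≤ √(delta γ ((m + 1 : ℕ) : ℝ) / L) * √(1 / ((m + 1 : ℕ) : ℝ)) := by positivity
  rw [add_sq, h1, h2]
  push_cast at h3 ⊢
  linarith

/-- Ensures that a uniform cell enlarged by `ε_k` on both sides is no longer than `3 ε_k`, the scale
in `η_k`. -/
theorem one_div_le_eps (γ : ℝ → Letter → ℝ) (L : ℝ) (m : ℕ) :
    1 / ((m : ℝ) + 1) ≤ eps γ L (m + 1) := by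
  refine le_trans ?_ (sqrt_one_div_le_eps L (m + 1))
  apply Real.le_sqrt_of_sq_le
  have h : (1 : ℝ) / ((m : ℝ) + 1) ≤ 1 := by
    rw [div_le_one (by positivity)]
    linarith [(Nat.cast_nonneg m : (0 : ℝ) ≤ m)]
  have h0 : (0 : ℝ) ≤ 1 / ((m : ℝ) + 1) := by positivity
  push_cast
  nlinarith

/-- Near the uniform separating times, the directions of the blocks are close to the true ones. -/
theorem direction_sub_trueDir_le (hγ : ContDiffOn ℝ 1 γ (Icc 0 1))
    (hL : ∀ t ∈ Icc (0 : ℝ) 1, l1 (vel γ t) = L) {m : ℕ} (hη : eta γ L (m + 1) < L)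
    {u : Fin m → ℝ} (hu : Near (eps γ L (m + 1)) u) (j : Fin (m + 1))
    (hj : lend u j < rend u j) :
    |direction (extVel γ) (lend u j) (rend u j) - trueDir γ (m + 1) j| ≤
      eta γ L (m + 1) / (2 * L) := by
  set ε := eps γ L (m + 1) with hε
  set K : ℝ := (m : ℝ) + 1 with hK
  have hK0 : 0 < K := by positivity
  have hεK : 1 / K ≤ ε := one_div_le_eps γ L m
  have hε0 : 0 < ε := lt_of_lt_of_le (by positivity) hεK
  have hl : (j : ℕ) / K - ε < lend u j := by
    revert j
    refine fun j => Fin.cases ?_ (fun i => ?_) j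
    · intro _
      simpa [lend] using hε0
    · intro _
      have := (abs_lt.1 (hu i)).1
      simp only [lend, Fin.cons_succ, Fin.val_succ]
      push_cast
      linarith
  have hr : rend u j < ((j : ℕ) + 1) / K + ε := by
    clear hl
    revert j
    refine fun j => Fin.lastCases ?_ (fun i => ?_) j
    · intro _
      simp only [rend, Fin.snoc_last, Fin.val_last]
      rw [← hK, div_self hK0.ne']
      linarith
    · intro _
      have := (abs_lt.1 (hu i)).2
      simp only [rend, Fin.snoc_castSucc, Fin.val_castSucc]
      linarith
  have hdiv : ((j : ℕ) + 1) / K = (j : ℕ) / K + 1 / K := add_div _ _ _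
  have hK1 : 0 < 1 / K := by positivity
  rw [trueDir_eq_direction hγ, ← hK]
  -- The interval `[α, β]` contains both the block and the uniform cell, and its length is below `1
  -- / K + 2 ε ≤ 3 ε`.
  refine direction_sub_le (α := min (lend u j) ((j : ℕ) / K))
    (β := max (rend u j) (((j : ℕ) + 1) / K)) (continuous_extVel hγ) (l1_extVel hL) hη ?_ hj
    (by linarith) (Icc_subset_Icc (min_le_left _ _) (le_max_left _ _))
    (Icc_subset_Icc (min_le_right _ _) (le_max_right _ _))
  intro s hs t ht
  refine l1_extVel_sub_le_eta hL ?_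
  have hα : (j : ℕ) / K - ε < min (lend u j) ((j : ℕ) / K) := lt_min hl (by linarith)
  have hβ : max (rend u j) (((j : ℕ) + 1) / K) < ((j : ℕ) + 1) / K + ε := max_lt hr (by linarith)
  rw [← hε, abs_lt]
  constructor <;> linarith [hs.1, hs.2, ht.1, ht.2]

theorem badMass_lt_half_totalMass (hγ : ContDiffOn ℝ 1 γ (Icc 0 1))
    (hL : ∀ t ∈ Icc (0 : ℝ) 1, l1 (vel γ t) = L) (hL0 : 0 < L) {c : ℝ} (hc : 0 < c) {m n : ℕ}
    (hcη : c / ((m : ℝ) + 1) ≤ eta γ L (m + 1) ^ 2) (hm : 8 ≤ (m : ℝ) + 1)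
    (hδ : delta γ ((m + 1 : ℕ) : ℝ) ≤ L / 2) (hη : eta γ L (m + 1) ≤ L / 4)
    (hlog : 7 / (c / L ^ 2) + 1 ≤ Real.log ((m : ℝ) + 1))
    (hn : ((m : ℝ) + 1) ^ 2 * Real.log ((m : ℝ) + 1) - 1 < n) {θ : ℝ}
    (hθ : eta γ L (m + 1) / L ≤ θ) :
    badMass γ n m θ (trueDir γ (m + 1)) < totalMass γ n (m + 1) / 2 := by
  set v := extVel γ with hv
  have hvc : Continuous v := continuous_extVel hγ
  have hvL : ∀ t, l1 (v t) = L := l1_extVel hL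
  have hvv : ∀ t ∈ Icc (0 : ℝ) 1, v t = vel γ t := fun t ht => extVel_eq ht
  set ε := eps γ L (m + 1) with hε
  set η := eta γ L (m + 1) with hηdef
  set δ := delta γ ((m + 1 : ℕ) : ℝ) with hδdef
  set K : ℝ := (m : ℝ) + 1 with hK
  have hK0 : 0 < K := by linarith
  have hε0 : 0 < ε := lt_of_lt_of_le (by positivity) (one_div_le_eps γ L m)
  have hη0 : 0 ≤ η := delta_nonneg _
  have hδ0 : 0 ≤ δ := delta_nonneg _
  have hlog1 : 1 ≤ Real.log K := le_trans (by
    have : 0 < 7 / (c / L ^ 2) := by positivity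
    linarith) hlog
  have hn0 : 0 < n := by
    have : (0 : ℝ) < n := lt_of_le_of_lt (by nlinarith) hn
    exact_mod_cast this
  have hθ0 : 0 ≤ θ := le_trans (by positivity) hθ
  have hθ2 : c / L ^ 2 / K ≤ θ ^ 2 := by
    have h1 : (η / L) ^ 2 ≤ θ ^ 2 := pow_le_pow_left₀ (by positivity) hθ 2
    refine le_trans ?_ h1
    rw [div_pow, div_right_comm]
    gcongr
  have hbad := badMass_le hvc hvv hvL hL0.le hn0 hε0.le hθ0 (trueDir γ (m + 1))
    fun u _ hu j hj => (direction_sub_trueDir_le hγ hL (by linarith) hu j hj).trans (by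
      rw [← hηdef, mul_comm 2 L, ← div_div]
      linarith)
  -- At a uniform time the dominant letter has velocity at least `L / 2` in absolute value; moving
  -- by less than `ε` changes it by at most `η ≤ L / 4`, which leaves `L / 4` with the same sign.
  choose w σ hσ hw using fun i : Fin m => exists_dominant_letter (v (((i : ℕ) + 1 : ℝ) / K))
  have htotal := le_totalMass hvc hvv hvL hL0.le n hε0.le w σ hσ fun u _ hu i => by
    have h1 : l1 (v (u i) - v (((i : ℕ) + 1 : ℝ) / K)) ≤ η :=
      l1_extVel_sub_le_eta hL ((hu i).trans (by linarith))
    have h2 := (abs_le_l1 _ (w i)).trans h1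
    have h3 := hw i
    rw [hvL] at h3
    have h4 : |σ i * (v (u i) (w i) - v (((i : ℕ) + 1 : ℝ) / K) (w i))| ≤ η := by
      rw [abs_mul, hσ, one_mul]
      exact h2
    have h5 := (abs_le.1 h4).1
    rw [mul_sub] at h5
    linarith
  have hδv : ∀ s t, |s - t| < 1 / K → l1 (v s - v t) ≤ δ := fun s t h =>
    l1_extVel_sub_le_delta hL (by push_cast; exact h)
  have hhlt : 1 / K ^ 3 < 1 / (2 * K) := by
    apply one_div_lt_one_div_of_lt (by positivity)
    have : K ^ 3 = K * K ^ 2 := by ring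
    nlinarith
  set b : ℝ := (divPow (2 * n) ((L - δ) * (1 / K - 1 / K ^ 3)) / 2) ^ (m + 1) with hb
  have hb0 : 0 < b := by
    have h1 : 1 / (2 * K) < 1 / K := one_div_lt_one_div_of_lt hK0 (by linarith)
    have h2 : 0 < (L - δ) * (1 / K - 1 / K ^ 3) := mul_pos (by linarith) (by linarith)
    rw [hb]
    unfold divPow
    positivity
  -- Side `1 / K ^ 3` shortens a block by a relative `1 / K ^ 2` at most. This costs `exp (4n/K²)`
  -- per block, less than the gain `exp (4n/K)`, while the volume costs only `K³` per separating
  -- time.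
  have hA := le_simplexInt_of_box (c := b) (h := 1 / K ^ 3) (continuous_weightProd hvc n m)
    (s := 0) zero_le_one (by positivity) (fun i => ((i : ℕ) + 1 : ℝ) / K)
    (fun u _ => weightProd_nonneg n u) fun u hu =>
      le_weightProd_of_box hvc hvL n hδv (by linarith) hhlt u hu (by positivity)
  have hA0 : 0 < simplexInt m (weightProd v n) 0 := lt_of_lt_of_le (by positivity) hA
  refine badMass_lt_of_small hL0 hA0 hbad htotal
    (tail_le_of_growth (by positivity) hlog hn hθ2) ?_
  refine (farBound_le hL0 (by linarith) hδ0 hδ (le_eps_sq γ hL0 m)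
    (le_exp_of_growth hm hn)).trans ?_
  exact mul_le_mul_of_nonneg_left hA (by positivity)

theorem badMass_nonneg (n m : ℕ) (θ : ℝ) (r : Fin (m + 1) → ℝ) : 0 ≤ badMass γ n m θ r :=
  Finset.sum_nonneg fun _ _ => Finset.sum_nonneg fun _ _ => abs_nonneg _

/-- A window of half-width `2 θ` whose centre is at least `3 θ` from `r j` misses the
`θ`-neighbourhood of `r j`; this is where the constant `3` comes from. -/
theorem blockMass_le_badMass {n m : ℕ} {θ : ℝ} {r : Fin (m + 1) → ℝ} (j : Fin (m + 1)) {q : ℝ}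
    (hq : 3 * θ ≤ |q - r j|) : blockMass γ n (m + 1) θ j q ≤ badMass γ n m θ r := by
  refine Finset.sum_le_sum fun w _ => Finset.sum_le_sum_of_subset_of_nonneg (fun l hl => ?_)
    fun _ _ _ => abs_nonneg _
  simp only [Finset.mem_filter, Finset.mem_univ, true_and] at hl ⊢
  refine ⟨j, ?_⟩
  have h := abs_sub_le q (((l j : ℕ) : ℝ) / n) (r j)
  rw [abs_sub_comm q (((l j : ℕ) : ℝ) / n)] at h
  linarith

theorem windowMass_le_blockMass {n k : ℕ} {θ : ℝ} (ρ : Fin k → ℝ) (j : Fin k) :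
    windowMass γ n k θ ρ ≤ blockMass γ n k θ j (ρ j) := by
  refine Finset.sum_le_sum fun w _ => Finset.sum_le_sum_of_subset_of_nonneg (fun l hl => ?_)
    fun _ _ _ => abs_nonneg _
  simp only [Finset.mem_filter, Finset.mem_univ, true_and] at hl ⊢
  exact hl j

theorem totalMass_le_windowMass_add_badMass {n m : ℕ} {θ : ℝ} (hθ : 0 < θ)
    (r : Fin (m + 1) → ℝ) :
    totalMass γ n (m + 1) ≤ windowMass γ n (m + 1) θ r + badMass γ n m θ r := by
  unfold totalMass windowMass badMass
  refine le_trans (Finset.sum_le_sum fun w _ => ?_) Finset.sum_add_distrib.le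
  rw [← Finset.sum_filter_add_sum_filter_not Finset.univ
    (fun l : Fin (m + 1) → Fin (n + 1) => ∀ j, |((l j : ℕ) : ℝ) / n - r j| < 2 * θ)]
  refine add_le_add le_rfl (Finset.sum_le_sum_of_subset_of_nonneg (fun l hl => ?_)
    fun _ _ _ => abs_nonneg _)
  simp only [Finset.mem_filter, Finset.mem_univ, true_and, not_forall, not_lt] at hl ⊢
  obtain ⟨j, hj⟩ := hl
  exact ⟨j, by linarith⟩

end SymSig

end

theorem mainTheorem4 (γ : ℝ → SymSig.Letter → ℝ) (L : ℝ)
    (hγ : ContDiffOn ℝ 1 γ (Icc 0 1))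
    (hL : ∀ t ∈ Icc (0 : ℝ) 1, SymSig.l1 (SymSig.vel γ t) = L)
    (hne : ∃ s ∈ Icc (0 : ℝ) 1, ∃ t ∈ Icc (0 : ℝ) 1, SymSig.vel γ s ≠ SymSig.vel γ t) :
    ∀ᶠ k : ℕ in atTop, ∀ n : ℕ, |(n : ℝ) - (k : ℝ) ^ 2 * Real.log k| < 1 →
      ∀ θ : ℝ, SymSig.eta γ L k / L ≤ θ →
        (∃ ρ : Fin k → ℝ, (∀ j, ρ j ∈ Icc (0 : ℝ) 1) ∧
          SymSig.windowMass γ n k θ ρ / SymSig.totalMass γ n k > 1 / 2) ∧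
        (∀ ρ : Fin k → ℝ,
          SymSig.windowMass γ n k θ ρ / SymSig.totalMass γ n k > 1 / 2 →
            ∀ j, |ρ j - SymSig.trueDir γ k j| < 3 * θ) ∧
        (∀ (j : Fin k) (q : ℝ),
          SymSig.blockMass γ n k θ j q / SymSig.totalMass γ n k > 1 / 2 →
            |q - SymSig.trueDir γ k j| < 3 * θ) := by
  -- For `L = 0` the velocity would vanish identically, hence be constant.
  have hL0 : 0 < L := by
    refine lt_of_le_of_ne ((SymSig.l1_nonneg _).trans_eq (hL 0 ⟨le_rfl, zero_le_one⟩)) fun h0 => ?_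
    obtain ⟨s, hs, t, ht, hst⟩ := hne
    have hzero : ∀ r ∈ Icc (0 : ℝ) 1, SymSig.vel γ r = 0 := fun r hr => funext fun i =>
      abs_nonpos_iff.1 ((SymSig.abs_le_l1 _ i).trans_eq ((hL r hr).trans h0.symm))
    exact hst ((hzero s hs).trans (hzero t ht).symm)
  obtain ⟨c, hc, hcη⟩ := SymSig.exists_le_eta_sq hL hne
  have hlog : Tendsto (fun k : ℕ => Real.log k) atTop atTop :=
    Real.tendsto_log_atTop.comp tendsto_natCast_atTop_atTop
  filter_upwards [eventually_ge_atTop 8,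
    (SymSig.tendsto_delta_nat hγ).eventually (ge_mem_nhds (half_pos hL0)),
    (SymSig.tendsto_eta hγ L).eventually (ge_mem_nhds (by positivity : 0 < L / 4)),
    hlog.eventually_ge_atTop (7 / (c / L ^ 2) + 1)] with k hk8 hδ hη hlogk n hn θ hθ
  obtain ⟨m, rfl⟩ : ∃ m, k = m + 1 := ⟨k - 1, by omega⟩
  have hcast : ((m + 1 : ℕ) : ℝ) = (m : ℝ) + 1 := by push_cast; rfl
  have hcη' := hcη (m + 1) (Nat.succ_pos m)
  rw [hcast] at hn hlogk hcη'
  -- Nonconstancy makes `η_k`, and so `θ`, strictly positive; otherwise the strict windows would be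
  -- empty.
  have hη0 : 0 < SymSig.eta γ L (m + 1) :=
    lt_of_le_of_ne (SymSig.delta_nonneg _) fun h => by
      rw [← h] at hcη'
      have : 0 < c / ((m : ℝ) + 1) := by positivity
      norm_num at hcη'
      linarith
  have hθ0 : 0 < θ := (div_pos hη0 hL0).trans_le hθ
  have hbad := SymSig.badMass_lt_half_totalMass (n := n) hγ hL hL0 hc hcη'
    (by rw [← hcast]; exact_mod_cast hk8) hδ hη hlogk (by linarith [(abs_lt.1 hn).1]) hθ
  have htot : 0 < SymSig.totalMass γ n (m + 1) := by
    linarith [SymSig.badMass_nonneg (γ := γ) n m θ (SymSig.trueDir γ (m + 1))]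
  have hblock : ∀ (j : Fin (m + 1)) (q : ℝ),
      SymSig.blockMass γ n (m + 1) θ j q / SymSig.totalMass γ n (m + 1) > 1 / 2 →
        |q - SymSig.trueDir γ (m + 1) j| < 3 * θ := by
    intro j q hq
    by_contra hcon
    have h1 := SymSig.blockMass_le_badMass (γ := γ) (n := n) j (not_lt.1 hcon)
    rw [gt_iff_lt, lt_div_iff₀ htot] at hq
    linarith
  -- The true directions themselves serve as `ρ`: everything outside their window is bad. For
  -- arbitrary `ρ`, its window lies in each one-block window, so the second claim follows from the
  -- third.
  refine ⟨⟨SymSig.trueDir γ (m + 1), fun j => ?_, ?_⟩, fun ρ hρ j => hblock j (ρ j) ?_, hblock⟩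
  · rw [SymSig.trueDir_eq_direction hγ]
    exact SymSig.direction_mem _ _
  · have h1 := SymSig.totalMass_le_windowMass_add_badMass (γ := γ) (n := n) hθ0
      (SymSig.trueDir γ (m + 1))
    rw [gt_iff_lt, lt_div_iff₀ htot]
    linarith
  · exact hρ.trans_le (div_le_div_of_nonneg_right (SymSig.windowMass_le_blockMass ρ j) htot.le)
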